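/- Let $G$ be a simply connected nilpotent complex Lie group with Lie algebra $\mathfrak g$, let $\Gamma\subset G$ be a lattice, i.e. a discrete subgroup such that the quotient $X=\Gamma\backslash G$ by left translations is compact, and regard $X$ as a compact complex manifold (a complex parallelisable nilmanifold). If $\mathfrak g$ is not abelian, then $X$ has arbitrarily small deformations that are not complex parallelisable. Precisely: there exist a connected complex manifold $\mathcal X$, a proper holomorphic submersion $\pi:\mathcal X\to\Delta$ to the open unit disc $\Delta\subset\mathbb C$, and a biholomorphic map from $X$ onto the fibre $\pi^{-1}(0)$, such that for every $\varepsilon>0$ there is $t\in\Delta$ with $|t|<\varepsilon$ for which the compact complex manifold $\pi^{-1}(t)$ is not complex parallelisable. Here a complex manifold of dimension $n$ is called complex parallelisable if its holomorphic tangent bundle is holomorphically trivial, i.e. if it has $n$ holomorphic vector fields that are linearly independent at every point. -/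

import Mathlib

open scoped Manifold ContDiff Topology

universe u v

section LatticeQuotient

variable {E : Type v} [NormedAddCommGroup E] [NormedSpace ℂ E] [FiniteDimensional ℂ E]
  {G : Type u} [TopologicalSpace G] [ChartedSpace E G] [Group G]

/-- The space `Γ \ G` of orbits of a subgroup `Γ` of `G` acting on `G` by left multiplication, with
the quotient topology. -/
abbrev LatticeQuotient (Γ : Subgroup G) : Type u := MulAction.orbitRel.Quotient Γ G

theorem locallyCompactSpace_of_complexCharts (E : Type v) [NormedAddCommGroup E] [NormedSpace ℂ E]
    [FiniteDimensional ℂ E] (G : Type u) [TopologicalSpace G] [ChartedSpace E G] :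
    LocallyCompactSpace G :=
  haveI : ProperSpace E := FiniteDimensional.proper ℂ E
  ChartedSpace.locallyCompactSpace E G

theorem properlyDiscontinuousSMul_of_discrete {G : Type u} [TopologicalSpace G] [Group G]
    [IsTopologicalGroup G] [T2Space G] (Γ : Subgroup G) [DiscreteTopology Γ] :
    ProperlyDiscontinuousSMul Γ G :=
  Γ.properlyDiscontinuousSMul_of_tendsto_cofinite
    (Γ.tendsto_coe_cofinite_of_discrete (isDiscrete_iff_discreteTopology.2 inferInstance))

theorem isTopologicalGroup_of_complexLieGroup (E : Type v) [NormedAddCommGroup E]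
    [NormedSpace ℂ E] (G : Type u) [TopologicalSpace G] [ChartedSpace E G] [Group G]
    [LieGroup 𝓘(ℂ, E) ω G] : IsTopologicalGroup G :=
  topologicalGroup_of_lieGroup 𝓘(ℂ, E) ω

/-- The quotient `Γ \ G` of a complex Lie group by a discrete subgroup, with the complex structure
that makes the projection `G → Γ \ G` locally biholomorphic: its charts are the local sections of the
projection followed by charts of `G`. -/
noncomputable instance LatticeQuotient.instChartedSpace [LieGroup 𝓘(ℂ, E) ω G] [T2Space G]
    (Γ : Subgroup G) [DiscreteTopology Γ] : ChartedSpace E (LatticeQuotient Γ) :=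
  haveI : IsTopologicalGroup G := isTopologicalGroup_of_complexLieGroup E G
  haveI : LocallyCompactSpace G := locallyCompactSpace_of_complexCharts E G
  haveI : ProperlyDiscontinuousSMul Γ G := properlyDiscontinuousSMul_of_discrete Γ
  MulAction.instChartedSpaceQuotient


/-- The transition maps between the charts of `Γ \ G` are holomorphic. -/
instance LatticeQuotient.instIsManifold [LieGroup 𝓘(ℂ, E) ω G] [T2Space G]
    (Γ : Subgroup G) [DiscreteTopology Γ] : IsManifold 𝓘(ℂ, E) ω (LatticeQuotient Γ) := by
  have : IsTopologicalGroup G := isTopologicalGroup_of_complexLieGroup E G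
  have : LocallyCompactSpace G := locallyCompactSpace_of_complexCharts E G
  have : ProperlyDiscontinuousSMul Γ G := properlyDiscontinuousSMul_of_discrete Γ
  have hq : IsLocalHomeomorph (Quotient.mk _ : G → LatticeQuotient Γ) :=
    isQuotientCoveringMap_quotientMk_of_properlyDiscontinuousSMul.isCoveringMap.isLocalHomeomorph
  have key : ∀ g g' : G, ContDiffOn ℂ ω
      (((hq.localInverseAt g).trans (chartAt E g)).symm.trans
        ((hq.localInverseAt g').trans (chartAt E g')))
      (((hq.localInverseAt g).trans (chartAt E g)).symm.trans
        ((hq.localInverseAt g').trans (chartAt E g'))).source := by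
    intro g g' x hx
    simp only [OpenPartialHomeomorph.trans_source, OpenPartialHomeomorph.symm_source,
      OpenPartialHomeomorph.trans_target, OpenPartialHomeomorph.coe_trans_symm,
      Set.mem_inter_iff, Set.mem_preimage, Function.comp_apply,
      IsLocalHomeomorph.localInverseAt_symm] at hx
    obtain ⟨⟨hx1, hx2⟩, hx3, hx4⟩ := hx
    set a : G := (chartAt E g).symm x with ha
    set s := hq.localInverseAt g' with hs
    let p : G → LatticeQuotient Γ := Quotient.mk _
    have hsec : ∀ y ∈ s.source, p (s y) = y := fun y hy => hq.apply_localInverseAt_of_mem hy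
    obtain ⟨γ, hγ⟩ : ∃ γ : Γ, (γ : G) * a = s (p a) := by
      have := Quotient.exact (hsec _ hx3)
      exact this
    have hcont : ContinuousAt (fun b => s (p b) * b⁻¹) a :=
      ((s.continuousAt hx3).comp (hq.continuous.continuousAt)).mul continuousAt_inv
    have hev : ∀ᶠ b in 𝓝 a, s (p b) = γ * b := by
      obtain ⟨U, hU, hUΓ⟩ : ∃ U : Set G, IsOpen U ∧ (Subtype.val : Γ → G) ⁻¹' U = {γ} :=
        isOpen_induced_iff.1 (isOpen_discrete ({γ} : Set Γ))
      have hγU : (γ : G) ∈ U := by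
        have : γ ∈ (Subtype.val : Γ → G) ⁻¹' U := by rw [hUΓ]; rfl
        exact this
      have h1 : ∀ᶠ b in 𝓝 a, s (p b) * b⁻¹ ∈ U := by
        apply hcont.eventually_mem
        apply hU.mem_nhds
        simpa [← hγ] using hγU
      have h2 : ∀ᶠ b in 𝓝 a, p b ∈ s.source :=
        hq.continuous.continuousAt.eventually_mem (s.open_source.mem_nhds hx3)
      filter_upwards [h1, h2] with b hb1 hb2
      obtain ⟨δ, hδ⟩ : ∃ δ : Γ, (δ : G) * b = s (p b) := Quotient.exact (hsec _ hb2)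
      have : δ ∈ (Subtype.val : Γ → G) ⁻¹' U := by
        simpa [← hδ] using hb1
      rw [hUΓ] at this
      rw [← hδ, Set.mem_singleton_iff.1 this]
    have hsymm : ContMDiffAt 𝓘(ℂ, E) 𝓘(ℂ, E) ω (chartAt E g).symm x :=
      (contMDiffOn_chart_symm (I := 𝓘(ℂ, E)) (n := ω) (x := g)).contMDiffAt
        ((chartAt E g).open_target.mem_nhds hx1)
    have hmul : ContMDiffAt 𝓘(ℂ, E) 𝓘(ℂ, E) ω (fun b : G => (γ : G) * b) a :=
      (contMDiff_mul_left (I := 𝓘(ℂ, E)) (n := ω) (a := (γ : G))).contMDiffAt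
    have hch : ContMDiffAt 𝓘(ℂ, E) 𝓘(ℂ, E) ω (chartAt E g') ((γ : G) * a) := by
      apply (contMDiffOn_chart (I := 𝓘(ℂ, E)) (n := ω) (x := g')).contMDiffAt
      apply (chartAt E g').open_source.mem_nhds
      rw [hγ]; exact hx4
    have htot : ContMDiffAt 𝓘(ℂ, E) 𝓘(ℂ, E) ω
        (fun y => chartAt E g' ((γ : G) * (chartAt E g).symm y)) x :=
      ContMDiffAt.comp (g := chartAt E g') x hch (ContMDiffAt.comp (g := fun b => (γ : G) * b) x hmul hsymm)
    refine (htot.contDiffAt.congr_of_eventuallyEq ?_).contDiffWithinAt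
    have hc : ContinuousAt (chartAt E g).symm x := (chartAt E g).symm.continuousAt hx1
    filter_upwards [hc.eventually hev] with y hy
    simp only [OpenPartialHomeomorph.coe_trans, OpenPartialHomeomorph.coe_trans_symm,
      Function.comp_apply, IsLocalHomeomorph.localInverseAt_symm]
    exact congrArg _ hy
  refine isManifold_of_contDiffOn _ _ _ ?_
  rintro e e' ⟨q, rfl⟩ ⟨q', rfl⟩
  simpa using key _ _

end LatticeQuotient

section Deformations

/-- A complex manifold `M` with model space `E` is complex parallelisable if its holomorphic tangent
bundle is holomorphically trivial: there are `dim M` holomorphic vector fields on `M` that are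
linearly independent over `ℂ` at every point. -/
def IsComplexParallelisable (E : Type v) [NormedAddCommGroup E] [NormedSpace ℂ E]
    (M : Type u) [TopologicalSpace M] [ChartedSpace E M] [IsManifold 𝓘(ℂ, E) ω M] : Prop :=
  ∃ V : Fin (Module.finrank ℂ E) → (x : M) → TangentSpace 𝓘(ℂ, E) x,
    (∀ i, ContMDiff 𝓘(ℂ, E) 𝓘(ℂ, E).tangent ω
      (fun x => (⟨x, V i x⟩ : TangentBundle 𝓘(ℂ, E) M))) ∧
    ∀ x, LinearIndependent ℂ (fun i => V i x)

variable (E : Type v) [NormedAddCommGroup E] [NormedSpace ℂ E]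
  (E₀ : Type*) [NormedAddCommGroup E₀] [NormedSpace ℂ E₀]
  {Y : Type*} [TopologicalSpace Y] [ChartedSpace (E × E₀) Y]
  {B : Type*} [TopologicalSpace B] [ChartedSpace E₀ B]

/-- `κ : F → Y` is a biholomorphic map of the complex manifold `F` onto the fibre `π ⁻¹ (b)`, a
complex submanifold of `Y` when `π : Y → B` is a holomorphic submersion. -/
structure IsFibreEmbedding {F : Type*} [TopologicalSpace F] [ChartedSpace E F]
    (π : Y → B) (b : B) (κ : F → Y) : Prop where
  isSmoothEmbedding : Manifold.IsSmoothEmbedding 𝓘(ℂ, E) 𝓘(ℂ, E × E₀) ω κ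
  range_eq : Set.range κ = π ⁻¹' {b}

/-- A deformation of the compact complex manifold `X` over the complex manifold `B` with base point
`b₀`: a proper holomorphic submersion `π : Y → B` together with an isomorphism `ι` of `X` with the
fibre of `π` over `b₀`. -/
structure IsDeformation {X : Type*} [TopologicalSpace X] [ChartedSpace E X]
    (π : Y → B) (b₀ : B) (ι : X → Y) : Prop where
  isSubmersion : Manifold.IsSubmersion 𝓘(ℂ, E × E₀) 𝓘(ℂ, E₀) ω π
  isProperMap : IsProperMap π
  isFibreEmbedding : IsFibreEmbedding E E₀ π b₀ ι

/-- The open unit disc in `ℂ`, as a complex manifold. -/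
abbrev openUnitDisc : TopologicalSpace.Opens ℂ := ⟨Metric.ball 0 1, Metric.isOpen_ball⟩

/-- The standard complex structure of the disc, given by its inclusion in `ℂ`. -/
noncomputable instance openUnitDisc.instChartedSpace : ChartedSpace ℂ openUnitDisc :=
  letI : ChartedSpace ℂ ℂ := chartedSpaceSelf ℂ
  TopologicalSpace.Opens.instChartedSpace (H := ℂ) (M := ℂ) openUnitDisc

instance openUnitDisc.instIsManifold : IsManifold 𝓘(ℂ, ℂ) ω openUnitDisc :=
  letI : ChartedSpace ℂ ℂ := chartedSpaceSelf ℂ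
  { toHasGroupoid := inferInstanceAs (HasGroupoid openUnitDisc (contDiffGroupoid ω 𝓘(ℂ, ℂ))) }

/-- The centre of the unit disc. -/
def openUnitDisc.centre : openUnitDisc := ⟨0, Metric.mem_ball_self one_pos⟩

end Deformations

/-! Since $\mathfrak g$ is nilpotent and not abelian, there are a linear form `ℓ` that kills all
triple brackets and vectors `v`, `w` with `ℓ [v, w] ≠ 0`
(`exists_dual_vanishing_on_triple_brackets`). Let `ψ s = exp (s v)` and `lam g = ℓ (Ad g v) - ℓ v`.
Because `ℓ` kills triple brackets, `lam` is a nonzero holomorphic homomorphism `G → ℂ`; it vanishes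
on `ψ` because `[v, v] = 0`. The form `m x = ℓ [v, x]` is nonzero and `Ad`-invariant, and `ℓ (Ad (ψ
s) x) = ℓ x + s * m x` (`exists_twistData`).

The deformation lets `γ ∈ Γ` act on `G × Δ` by `(g, t) ↦ (γ * g * ψ (-(t * conj (lam γ))), t)`. This
is holomorphic in `(g, t)`, because the conjugation touches only the constant `lam γ`. The
real-analytic fibrewise map `g ↦ g * ψ (t * conj (lam g))` conjugates it to plain left
multiplication. So the quotient is homeomorphic to `X × Δ`, but with a twisted complex structure
(`TwistData.exists_deformation`).

For `t ≠ 0` the fibre is not parallelisable (`LieGroupChart.not_isComplexParallelisable`). A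
holomorphic vector field on it, lifted to `G` and written in the left-invariant frame, is a
holomorphic `f : G → E` that is multiplied by `Ad (ψ (t * conj (lam γ)))` under the action of `γ`.
Then `m ∘ f` is invariant, hence constant by the maximum principle. A holomorphic frame would
contain a field for which this constant `c` is nonzero. For that field, `ℓ ∘ f` is holomorphic with
periods `t * c * conj (lam γ)`. Comparing it with the holomorphic function `conj (t * c) * lam`,
whose periods are the conjugates, and applying the maximum principle to real and imaginary parts,
forces `lam` to be constant, hence zero: a contradiction. -/

/-! ### Complex structures on quotients by local deck transformations. -/

section LocalHomeomorphCharts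

variable {𝕜 : Type*} [NontriviallyNormedField 𝕜] {E : Type*} [NormedAddCommGroup E]
  [NormedSpace 𝕜 E] {M : Type*} [TopologicalSpace M] [ChartedSpace E M]
  {Y : Type*} [TopologicalSpace Y] {p : M → Y}

/-- Any two points of a fibre of `p` are exchanged by a local holomorphic deck transformation. -/
def HasLocalDecks (𝕜 : Type*) [NontriviallyNormedField 𝕜] (E : Type*) [NormedAddCommGroup E]
    [NormedSpace 𝕜 E] {M : Type*} [TopologicalSpace M] [ChartedSpace E M]
    {Y : Type*} (p : M → Y) : Prop :=
  ∀ a b : M, p a = p b → ∃ τ : M → M, ContMDiffAt 𝓘(𝕜, E) 𝓘(𝕜, E) ω τ a ∧ τ a = b ∧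
    ∀ x, p (τ x) = p x

/-- A local section composed with `p` moves each point within its fibre. Near `a` it coincides with
the deck transformation `τ` sending `a` into the chosen sheet, because `τ x` stays in that sheet and
`p (τ x) = p x`. -/
theorem HasLocalDecks.contMDiffAt_localInverseAt_comp (hd : HasLocalDecks 𝕜 E p)
    (hp : IsLocalHomeomorph p) (b a : M) (ha : p a ∈ (hp.localInverseAt b).source) :
    ContMDiffAt 𝓘(𝕜, E) 𝓘(𝕜, E) ω (fun x => hp.localInverseAt b (p x)) a := by
  obtain ⟨τ, hτ, hτa, hpτ⟩ := hd a (hp.localInverseAt b (p a))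
    (hp.apply_localInverseAt_of_mem ha).symm
  refine hτ.congr_of_eventuallyEq ?_
  have h1 : ∀ᶠ x in 𝓝 a, τ x ∈ (hp.localInverseAt b).target := by
    apply hτ.continuousAt.eventually_mem
    apply (hp.localInverseAt b).open_target.mem_nhds
    rw [hτa]
    exact (hp.localInverseAt b).map_source ha
  filter_upwards [h1] with x hx
  have := (hp.localInverseAt b).right_inv hx
  rwa [hp.localInverseAt_symm, hpτ] at this

variable [IsManifold 𝓘(𝕜, E) ω M]

theorem HasLocalDecks.isManifold (hd : HasLocalDecks 𝕜 E p) (hp : IsLocalHomeomorph p)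
    (hs : Function.Surjective p) :
    letI : ChartedSpace E Y := hp.chartedSpace hs
    IsManifold 𝓘(𝕜, E) ω Y := by
  let : ChartedSpace E Y := hp.chartedSpace hs
  have key : ∀ g g' : M, ContDiffOn 𝕜 ω
      (((hp.localInverseAt g).trans (chartAt E g)).symm.trans
        ((hp.localInverseAt g').trans (chartAt E g')))
      (((hp.localInverseAt g).trans (chartAt E g)).symm.trans
        ((hp.localInverseAt g').trans (chartAt E g'))).source := by
    intro g g' x hx
    simp only [OpenPartialHomeomorph.trans_source, OpenPartialHomeomorph.symm_source,
      OpenPartialHomeomorph.trans_target, OpenPartialHomeomorph.coe_trans_symm,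
      Set.mem_inter_iff, Set.mem_preimage, Function.comp_apply,
      IsLocalHomeomorph.localInverseAt_symm] at hx
    obtain ⟨⟨hx1, hx2⟩, hx3, hx4⟩ := hx
    have hsymm : ContMDiffAt 𝓘(𝕜, E) 𝓘(𝕜, E) ω (chartAt E g).symm x :=
      (contMDiffOn_chart_symm (I := 𝓘(𝕜, E)) (n := ω) (x := g)).contMDiffAt
        ((chartAt E g).open_target.mem_nhds hx1)
    have hch := (contMDiffOn_chart (I := 𝓘(𝕜, E)) (n := ω) (x := g')).contMDiffAt
      ((chartAt E g').open_source.mem_nhds hx4)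
    have hmid := hd.contMDiffAt_localInverseAt_comp hp g' _ hx3
    have htot := ContMDiffAt.comp (g := chartAt E g') x hch
      (ContMDiffAt.comp (g := fun y => hp.localInverseAt g' (p y)) x hmid hsymm)
    refine (htot.contDiffAt.congr_of_eventuallyEq ?_).contDiffWithinAt
    refine Filter.Eventually.of_forall fun y => ?_
    simp only [OpenPartialHomeomorph.coe_trans, OpenPartialHomeomorph.coe_trans_symm,
      Function.comp_apply, IsLocalHomeomorph.localInverseAt_symm]
  refine isManifold_of_contDiffOn _ _ _ ?_
  rintro e e' ⟨q, rfl⟩ ⟨q', rfl⟩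
  simpa using key _ _

/-- The preferred chart of `Y` at `p a` comes from one chosen preimage `b` of `p a`, which need not
be `a`. A deck transformation from `a` to `b` transfers the statement from the chosen sheet to the
given one. -/
theorem HasLocalDecks.isLocalDiffeomorph (hd : HasLocalDecks 𝕜 E p) (hp : IsLocalHomeomorph p)
    (hs : Function.Surjective p) :
    letI : ChartedSpace E Y := hp.chartedSpace hs
    IsLocalDiffeomorph 𝓘(𝕜, E) 𝓘(𝕜, E) ω p := by
  let : ChartedSpace E Y := hp.chartedSpace hs
  have : IsManifold 𝓘(𝕜, E) ω Y := hd.isManifold hp hs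
  have hsec : ∀ y : Y, ∃ b : M, p b = y ∧
      chartAt E y = (hp.localInverseAt b).trans (chartAt E b) := fun y =>
    ⟨_, hs.hasRightInverse.choose_spec y, rfl⟩
  have hpC : ∀ a, ContMDiffAt 𝓘(𝕜, E) 𝓘(𝕜, E) ω p a := by
    intro a
    obtain ⟨b, hb, hc⟩ := hsec (p a)
    obtain ⟨τ, hτ, hτa, hpτ⟩ := hd a b hb.symm
    have h1 : ContMDiffAt 𝓘(𝕜, E) 𝓘(𝕜, E) ω (chartAt E (p a)).symm
        (chartAt E b (τ a)) := by
      apply (contMDiffOn_chart_symm (I := 𝓘(𝕜, E)) (n := ω) (x := p a)).contMDiffAt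
      apply (chartAt E (p a)).open_target.mem_nhds
      rw [hτa, hc]
      simp
    have h2 : ContMDiffAt 𝓘(𝕜, E) 𝓘(𝕜, E) ω (chartAt E b) (τ a) := by
      apply (contMDiffOn_chart (I := 𝓘(𝕜, E)) (n := ω) (x := b)).contMDiffAt
      apply (chartAt E b).open_source.mem_nhds
      rw [hτa]; exact mem_chart_source E b
    refine (ContMDiffAt.comp (g := (chartAt E (p a)).symm) a h1
      (ContMDiffAt.comp (g := chartAt E b) a h2 hτ)).congr_of_eventuallyEq ?_
    have h3 : ∀ᶠ x in 𝓝 a, τ x ∈ (chartAt E b).source := by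
      apply hτ.continuousAt.eventually_mem
      apply (chartAt E b).open_source.mem_nhds
      rw [hτa]; exact mem_chart_source E b
    filter_upwards [h3] with x hx
    rw [hc]
    simp [(chartAt E b).left_inv hx, hpτ]
  have hinv : ∀ a, ∀ y ∈ (hp.localInverseAt a).source,
      ContMDiffAt 𝓘(𝕜, E) 𝓘(𝕜, E) ω (hp.localInverseAt a) y := by
    intro a y hy
    obtain ⟨b, hb, hc⟩ := hsec y
    have hyb : y ∈ (hp.localInverseAt b).source := hb ▸ hp.apply_self_mem_localInverseAt_source
    have hsb : hp.localInverseAt b y = b := by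
      have h := (hp.localInverseAt b).right_inv (hp.self_mem_localInverseAt_target (x := b))
      rwa [hp.localInverseAt_symm, hb] at h
    have h1 : ContMDiffAt 𝓘(𝕜, E) 𝓘(𝕜, E) ω (hp.localInverseAt b) y := by
      have h2 : ContMDiffAt 𝓘(𝕜, E) 𝓘(𝕜, E) ω (chartAt E b).symm (chartAt E y y) := by
        apply (contMDiffOn_chart_symm (I := 𝓘(𝕜, E)) (n := ω) (x := b)).contMDiffAt
        apply (chartAt E b).open_target.mem_nhds
        rw [hc]
        simp [hsb]
      have h3 : ContMDiffAt 𝓘(𝕜, E) 𝓘(𝕜, E) ω (chartAt E y) y :=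
        (contMDiffOn_chart (I := 𝓘(𝕜, E)) (n := ω) (x := y)).contMDiffAt
          ((chartAt E y).open_source.mem_nhds (mem_chart_source E y))
      refine (ContMDiffAt.comp (g := (chartAt E b).symm) y h2 h3).congr_of_eventuallyEq ?_
      filter_upwards [(chartAt E y).open_source.mem_nhds (mem_chart_source E y)] with z hz
      rw [hc] at hz ⊢
      simp only [OpenPartialHomeomorph.trans_source, Set.mem_inter_iff, Set.mem_preimage] at hz
      simp [(chartAt E b).left_inv hz.2]
    have h4 := hd.contMDiffAt_localInverseAt_comp (𝕜 := 𝕜) hp a (hp.localInverseAt b y)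
      (by rwa [hsb, hb])
    refine (ContMDiffAt.comp (g := fun x => hp.localInverseAt a (p x)) y h4
      h1).congr_of_eventuallyEq ?_
    filter_upwards [(hp.localInverseAt b).open_source.mem_nhds hyb] with z hz
    simp [hp.apply_localInverseAt_of_mem hz]
  intro a
  refine ⟨{ toPartialEquiv := (hp.localInverseAt a).symm.toPartialEquiv
            open_source := (hp.localInverseAt a).open_target
            open_target := (hp.localInverseAt a).open_source
            contMDiffOn_toFun := ?_
            contMDiffOn_invFun := fun y hy => (hinv a y hy).contMDiffWithinAt }, ?_, ?_⟩
  · have : ((hp.localInverseAt a).symm.toPartialEquiv : M → Y) = p := hp.localInverseAt_symm a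
    rw [this]
    exact fun x _ => (hpC x).contMDiffWithinAt
  · exact hp.self_mem_localInverseAt_target
  · intro x _
    exact (congrFun (hp.localInverseAt_symm a) x).symm

end LocalHomeomorphCharts

/-! ### Immersions and submersions read off from a product covering. -/

/-- Serves to recentre a chart, so that the slice at a given base point has base coordinate `0`. -/
theorem trans_addRight_mem_maximalAtlas {𝕜 E M : Type*} [NontriviallyNormedField 𝕜]
    [NormedAddCommGroup E] [NormedSpace 𝕜 E] [TopologicalSpace M] [ChartedSpace E M]
    [IsManifold 𝓘(𝕜, E) ω M] {c : OpenPartialHomeomorph M E}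
    (hc : c ∈ IsManifold.maximalAtlas 𝓘(𝕜, E) ω M) (v : E) :
    c.trans (Homeomorph.addRight v).toOpenPartialHomeomorph ∈
      IsManifold.maximalAtlas 𝓘(𝕜, E) ω M := by
  apply OpenPartialHomeomorph.mem_maximalAtlas_of_contMDiffOn
  · rw [OpenPartialHomeomorph.coe_trans]
    refine ContMDiffOn.comp (I' := 𝓘(𝕜, E)) (t := Set.univ) ?_
      ((contMDiffOn_of_mem_maximalAtlas hc).mono ?_) (fun _ _ => Set.mem_univ _)
    · rw [contMDiffOn_univ, contMDiff_iff_contDiff]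
      exact contDiff_id.add contDiff_const
    · intro x hx; exact hx.1
  · rw [OpenPartialHomeomorph.coe_trans_symm]
    refine ContMDiffOn.comp (I' := 𝓘(𝕜, E)) (t := c.target)
      (contMDiffOn_symm_of_mem_maximalAtlas hc) (ContMDiff.contMDiffOn ?_) ?_
    · rw [contMDiff_iff_contDiff]
      exact contDiff_id.add contDiff_const
    · intro x hx; exact hx.2

theorem IsLocalDiffeomorph.exists_openPartialHomeomorph {𝕜 E M Y : Type*}
    [NontriviallyNormedField 𝕜] [NormedAddCommGroup E] [NormedSpace 𝕜 E]
    [TopologicalSpace M] [ChartedSpace E M] [TopologicalSpace Y] [ChartedSpace E Y]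
    {p : M → Y} (hp : IsLocalDiffeomorph 𝓘(𝕜, E) 𝓘(𝕜, E) ω p) (x : M) {S : Set M}
    (hS : IsOpen S) (hx : x ∈ S) :
    ∃ θ : OpenPartialHomeomorph M Y, x ∈ θ.source ∧ θ.source ⊆ S ∧ (∀ y ∈ θ.source, θ y = p y) ∧
      ContMDiffOn 𝓘(𝕜, E) 𝓘(𝕜, E) ω θ θ.source ∧
      ContMDiffOn 𝓘(𝕜, E) 𝓘(𝕜, E) ω θ.symm θ.target := by
  obtain ⟨Φ, hΦ, hΦp⟩ := hp x
  refine ⟨Φ.toOpenPartialHomeomorph.restrOpen S hS, ⟨hΦ, hx⟩, fun y hy => hy.2,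
    fun y hy => (hΦp hy.1).symm, Φ.contMDiffOn_toFun.mono fun y hy => hy.1,
    Φ.contMDiffOn_invFun.mono fun y hy => ?_⟩
  have h := (Φ.toOpenPartialHomeomorph.restrOpen S hS).map_target hy
  rw [← (Φ.toOpenPartialHomeomorph.restrOpen S hS).right_inv hy]
  exact Φ.toOpenPartialHomeomorph.map_source h.1

theorem symm_trans_mem_maximalAtlas {𝕜 E M Y : Type*} [NontriviallyNormedField 𝕜]
    [NormedAddCommGroup E] [NormedSpace 𝕜 E]
    [TopologicalSpace M] [ChartedSpace E M] [IsManifold 𝓘(𝕜, E) ω M]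
    [TopologicalSpace Y] [ChartedSpace E Y] [IsManifold 𝓘(𝕜, E) ω Y]
    {θ : OpenPartialHomeomorph M Y} (h₁ : ContMDiffOn 𝓘(𝕜, E) 𝓘(𝕜, E) ω θ θ.source)
    (h₂ : ContMDiffOn 𝓘(𝕜, E) 𝓘(𝕜, E) ω θ.symm θ.target)
    {c : OpenPartialHomeomorph M E} (hc : c ∈ IsManifold.maximalAtlas 𝓘(𝕜, E) ω M) :
    θ.symm.trans c ∈ IsManifold.maximalAtlas 𝓘(𝕜, E) ω Y := by
  apply OpenPartialHomeomorph.mem_maximalAtlas_of_contMDiffOn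
  · rw [OpenPartialHomeomorph.coe_trans]
    exact (contMDiffOn_of_mem_maximalAtlas hc).comp (t := c.source)
      (h₂.mono fun y hy => hy.1) fun y hy => hy.2
  · rw [OpenPartialHomeomorph.coe_trans_symm, OpenPartialHomeomorph.symm_symm]
    exact h₁.comp (t := θ.source) ((contMDiffOn_symm_of_mem_maximalAtlas hc).mono
      fun y hy => hy.1) fun y hy => hy.2

section FibrationCharts

variable {𝕜 : Type*} [NontriviallyNormedField 𝕜] {E : Type*} [NormedAddCommGroup E]
  [NormedSpace 𝕜 E] {E₀ : Type*} [NormedAddCommGroup E₀] [NormedSpace 𝕜 E₀]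
  {M : Type*} [TopologicalSpace M] [ChartedSpace E M] [IsManifold 𝓘(𝕜, E) ω M]
  {B : Type*} [TopologicalSpace B] [ChartedSpace E₀ B] [IsManifold 𝓘(𝕜, E₀) ω B]

/-- The product of two charted spaces, modelled on the product vector space. -/
abbrev selfProdChartedSpace (E E₀ M B : Type*) [TopologicalSpace E] [TopologicalSpace E₀]
    [TopologicalSpace M] [ChartedSpace E M]
    [TopologicalSpace B] [ChartedSpace E₀ B] : ChartedSpace (E × E₀) (M × B) :=
  inferInstanceAs (ChartedSpace (ModelProd E E₀) (M × B))

attribute [local instance] selfProdChartedSpace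

theorem self_prod_eq : 𝓘(𝕜, E × E₀) = (𝓘(𝕜, E).prod 𝓘(𝕜, E₀)) := modelWithCornersSelf_prod

theorem isManifold_prod_self : IsManifold 𝓘(𝕜, E × E₀) ω (M × B) := by
  rw [self_prod_eq]
  exact IsManifold.prod (I := 𝓘(𝕜, E)) (I' := 𝓘(𝕜, E₀)) M B


/-- Lifted through the local diffeomorphisms `p` and `P`, the map `ι` is the slice inclusion `x ↦
(x, t)`, which is an immersion. -/
theorem isImmersion_of_slice
    {F : Type*} [TopologicalSpace F] [ChartedSpace E F] [IsManifold 𝓘(𝕜, E) ω F]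
    {Y : Type*} [TopologicalSpace Y] [ChartedSpace (E × E₀) Y] [IsManifold 𝓘(𝕜, E × E₀) ω Y]
    {p : M → F} (hp : IsLocalDiffeomorph 𝓘(𝕜, E) 𝓘(𝕜, E) ω p) (hs : Function.Surjective p)
    {P : M × B → Y} (hP : IsLocalDiffeomorph 𝓘(𝕜, E × E₀) 𝓘(𝕜, E × E₀) ω P) (t : B)
    {ι : F → Y} (hι : Continuous ι) (hιp : ∀ x, ι (p x) = P (x, t)) :
    Manifold.IsImmersion 𝓘(𝕜, E) 𝓘(𝕜, E × E₀) ω ι := by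
  have : IsManifold 𝓘(𝕜, E × E₀) ω (M × B) := isManifold_prod_self
  refine Manifold.IsImmersionOfComplement.isImmersion (F := E₀) fun y => ?_
  obtain ⟨g, rfl⟩ := hs y
  obtain ⟨Ψ, hΨ, -, hΨP, hΨ₁, hΨ₂⟩ :=
    hP.exists_openPartialHomeomorph (g, t) isOpen_univ (Set.mem_univ _)
  obtain ⟨Φ, hΦ, hΦS, hΦp, hΦ₁, hΦ₂⟩ := hp.exists_openPartialHomeomorph g
    (S := {x | (x, t) ∈ Ψ.source})
    (Ψ.open_source.preimage (by fun_prop : Continuous fun x : M => (x, t))) hΨ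
  -- The immersion normal form is `u ↦ (u, 0)`, so the base coordinate is translated to vanish at
  -- `t`.
  set c : OpenPartialHomeomorph (M × B) (E × E₀) :=
    (((chartAt E g).prod (chartAt E₀ t)).trans
      (Homeomorph.addRight ((0, -(chartAt E₀ t t)) : E × E₀)).toOpenPartialHomeomorph) with hcdef
  have hc0 : (chartAt E g).prod (chartAt E₀ t) ∈
      IsManifold.maximalAtlas 𝓘(𝕜, E × E₀) ω (M × B) := by
    rw [self_prod_eq]
    exact IsManifold.mem_maximalAtlas_prod (IsManifold.chart_mem_maximalAtlas _)
      (IsManifold.chart_mem_maximalAtlas _)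
  have hc : c ∈ IsManifold.maximalAtlas 𝓘(𝕜, E × E₀) ω (M × B) := by
    exact trans_addRight_mem_maximalAtlas hc0 _
  refine Manifold.IsImmersionAtOfComplement.mk_of_continuousAt hι.continuousAt
    (ContinuousLinearEquiv.refl 𝕜 (E × E₀))
    (Φ.symm.trans (chartAt E g)) (Ψ.symm.trans c) ?_ ?_
    (symm_trans_mem_maximalAtlas hΦ₁ hΦ₂ (IsManifold.chart_mem_maximalAtlas _))
    (symm_trans_mem_maximalAtlas hΨ₁ hΨ₂ hc) ?_
  · rw [← hΦp g hΦ]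
    simp [hΦ]
  · rw [hιp, ← hΨP _ hΨ]
    simp [hΨ, hcdef]
  · intro y hy
    simp only [OpenPartialHomeomorph.extend_target, OpenPartialHomeomorph.trans_target,
      OpenPartialHomeomorph.symm_target, modelWithCornersSelf_coe_symm, Set.preimage_id,
      modelWithCornersSelf_coe, Set.range_id, Set.inter_univ, Set.mem_inter_iff,
      Set.mem_preimage] at hy
    have h1 := hΦS hy.2
    simp [hΦp _ hy.2, hιp, ← hΨP _ h1, Ψ.left_inv h1, hcdef, (chartAt E g).right_inv hy.1]

theorem isSubmersion_of_slices
    {Y : Type*} [TopologicalSpace Y] [ChartedSpace (E × E₀) Y] [IsManifold 𝓘(𝕜, E × E₀) ω Y]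
    {P : M × B → Y} (hP : IsLocalDiffeomorph 𝓘(𝕜, E × E₀) 𝓘(𝕜, E × E₀) ω P)
    (hs : Function.Surjective P)
    {π : Y → B} (hπ : Continuous π) (hπP : ∀ a, π (P a) = a.2) :
    Manifold.IsSubmersion 𝓘(𝕜, E × E₀) 𝓘(𝕜, E₀) ω π := by
  have : IsManifold 𝓘(𝕜, E × E₀) ω (M × B) := isManifold_prod_self
  refine Manifold.IsSubmersionOfComplement.isSubmersion (F := E) fun y => ?_
  obtain ⟨a, rfl⟩ := hs y
  obtain ⟨Ψ, hΨ, -, hΨP, hΨ₁, hΨ₂⟩ :=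
    hP.exists_openPartialHomeomorph a isOpen_univ (Set.mem_univ _)
  have hc0 : (chartAt E a.1).prod (chartAt E₀ a.2) ∈
      IsManifold.maximalAtlas 𝓘(𝕜, E × E₀) ω (M × B) := by
    rw [self_prod_eq]
    exact IsManifold.mem_maximalAtlas_prod (IsManifold.chart_mem_maximalAtlas _)
      (IsManifold.chart_mem_maximalAtlas _)
  -- The submersion normal form projects to the first factor, whereas the base is the second factor
  -- of the model `E × E₀`; hence the swap `prodComm`.
  refine Manifold.IsSubmersionAtOfComplement.mk_of_continuousAt hπ.continuousAt
    (ContinuousLinearEquiv.prodComm 𝕜 E E₀)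
    (Ψ.symm.trans ((chartAt E a.1).prod (chartAt E₀ a.2))) (chartAt E₀ a.2) ?_ ?_
    (symm_trans_mem_maximalAtlas hΨ₁ hΨ₂ hc0) (IsManifold.chart_mem_maximalAtlas _) ?_
  · rw [← hΨP a hΨ]
    simp [hΨ]
  · rw [hπP]; exact mem_chart_source _ _
  · intro y hy
    simp only [OpenPartialHomeomorph.extend_target, OpenPartialHomeomorph.trans_target,
      OpenPartialHomeomorph.symm_target, modelWithCornersSelf_coe_symm, Set.preimage_id,
      modelWithCornersSelf_coe, Set.range_id, Set.inter_univ, Set.mem_inter_iff,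
      Set.mem_preimage, OpenPartialHomeomorph.prod_target] at hy
    have h1 := hπP (((chartAt E a.1).prod (chartAt E₀ a.2)).symm y)
    rw [← hΨP _ hy.2] at h1
    simp only [Function.comp_apply, OpenPartialHomeomorph.extend_coe,
      OpenPartialHomeomorph.extend_coe_symm, OpenPartialHomeomorph.coe_trans_symm,
      OpenPartialHomeomorph.symm_symm, modelWithCornersSelf_coe, modelWithCornersSelf_coe_symm,
      id_eq, h1]
    simp [(chartAt E₀ a.2).right_inv hy.1.2]

end FibrationCharts

theorem isLocalHomeomorph_mk (E : Type v) [NormedAddCommGroup E] [NormedSpace ℂ E]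
    [FiniteDimensional ℂ E] {G : Type u} [TopologicalSpace G] [ChartedSpace E G] [Group G]
    [LieGroup 𝓘(ℂ, E) ω G] [T2Space G] (Γ : Subgroup G) [DiscreteTopology Γ] :
    IsLocalHomeomorph (Quotient.mk _ : G → LatticeQuotient Γ) := by
  have : IsTopologicalGroup G := isTopologicalGroup_of_complexLieGroup E G
  have : LocallyCompactSpace G := locallyCompactSpace_of_complexCharts E G
  have : ProperlyDiscontinuousSMul Γ G := properlyDiscontinuousSMul_of_discrete Γ
  exact isQuotientCoveringMap_quotientMk_of_properlyDiscontinuousSMul.isCoveringMap.isLocalHomeomorph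

theorem t2Space_latticeQuotient (E : Type v) [NormedAddCommGroup E] [NormedSpace ℂ E]
    [FiniteDimensional ℂ E] {G : Type u} [TopologicalSpace G] [ChartedSpace E G] [Group G]
    [LieGroup 𝓘(ℂ, E) ω G] [T2Space G] (Γ : Subgroup G) [DiscreteTopology Γ] :
    T2Space (LatticeQuotient Γ) := by
  have : IsTopologicalGroup G := isTopologicalGroup_of_complexLieGroup E G
  have : LocallyCompactSpace G := locallyCompactSpace_of_complexCharts E G
  have : ProperlyDiscontinuousSMul Γ G := properlyDiscontinuousSMul_of_discrete Γ
  infer_instance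

/-! ### The twisted action and the deformation it defines. -/

section TwistedFamily

variable {E : Type v} [NormedAddCommGroup E] [NormedSpace ℂ E]
  {G : Type u} [TopologicalSpace G] [ChartedSpace E G] [Group G]

attribute [local instance] selfProdChartedSpace

/-- A one-parameter subgroup `ψ : ℂ → G` of a complex Lie group together with a holomorphic
homomorphism `lam : G → ℂ` that vanishes on it. -/
structure TwistData (E : Type v) [NormedAddCommGroup E] [NormedSpace ℂ E]
    (G : Type u) [TopologicalSpace G] [ChartedSpace E G] [Group G] where
  ψ : ℂ → G
  lam : G → ℂ
  contMDiff_ψ : ContMDiff 𝓘(ℂ, ℂ) 𝓘(ℂ, E) ω ψ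
  contMDiff_lam : ContMDiff 𝓘(ℂ, E) 𝓘(ℂ, ℂ) ω lam
  ψ_add : ∀ a b, ψ (a + b) = ψ a * ψ b
  lam_mul : ∀ g h, lam (g * h) = lam g + lam h
  lam_ψ : ∀ s, lam (ψ s) = 0

namespace TwistData

variable (D : TwistData E G)

@[simp] theorem ψ_zero : D.ψ 0 = 1 := by
  have := D.ψ_add 0 0
  simpa using this

theorem ψ_neg_mul (s : ℂ) : D.ψ (-s) * D.ψ s = 1 := by
  rw [← D.ψ_add, neg_add_cancel, D.ψ_zero]

/-- The real-analytic map of `G` that untwists the deformed action at the parameter `t`. -/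
def untwist (t : ℂ) (g : G) : G := g * D.ψ (t * starRingEnd ℂ (D.lam g))

/-- The deformed action of an element `γ` of `G` at the parameter `t`. -/
def deck (γ : G) (t : ℂ) (g : G) : G := γ * g * D.ψ (-(t * starRingEnd ℂ (D.lam γ)))

@[simp] theorem lam_untwist (t : ℂ) (g : G) : D.lam (D.untwist t g) = D.lam g := by
  simp [untwist, D.lam_mul, D.lam_ψ]

theorem lam_deck (γ : G) (t : ℂ) (g : G) : D.lam (D.deck γ t g) = D.lam γ + D.lam g := by
  simp [deck, D.lam_mul, D.lam_ψ]

/-- This is where additivity of `lam` and its vanishing on `ψ` enter: the factor `ψ (t * conj (lam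
γ))` created by untwisting cancels the one in the deformed action. Topologically the deformed
quotient is therefore `Γ \ G` for every `t`. -/
theorem untwist_deck (γ : G) (t : ℂ) (g : G) :
    D.untwist t (D.deck γ t g) = γ * D.untwist t g := by
  rw [untwist, lam_deck, deck, untwist, map_add, mul_add, D.ψ_add]
  have := D.ψ_neg_mul (t * starRingEnd ℂ (D.lam γ))
  simp only [mul_assoc]
  rw [← mul_assoc (D.ψ (-(t * starRingEnd ℂ (D.lam γ)))), this, one_mul]

theorem untwist_neg_untwist (t : ℂ) (g : G) : D.untwist (-t) (D.untwist t g) = g := by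
  rw [untwist, lam_untwist, untwist, mul_assoc, ← D.ψ_add]
  simp

theorem untwist_untwist_neg (t : ℂ) (g : G) : D.untwist t (D.untwist (-t) g) = g := by
  simpa using D.untwist_neg_untwist (-t) g

theorem continuous_untwist [IsTopologicalGroup G] :
    Continuous fun a : G × ℂ => D.untwist a.2 a.1 := by
  have h1 := D.contMDiff_ψ.continuous
  have h2 := D.contMDiff_lam.continuous
  have h3 : Continuous (starRingEnd ℂ) := RCLike.continuous_conj
  unfold untwist
  fun_prop

/-- The fibrewise untwisting homeomorphism. -/
def untwistHomeomorph [IsTopologicalGroup G] : G × openUnitDisc ≃ₜ G × openUnitDisc where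
  toFun a := (D.untwist a.2 a.1, a.2)
  invFun a := (D.untwist (-a.2) a.1, a.2)
  left_inv a := by simp [untwist_neg_untwist]
  right_inv a := by simp [untwist_untwist_neg]
  continuous_toFun := (D.continuous_untwist.comp
    (by fun_prop : Continuous fun a : G × openUnitDisc => (a.1, (a.2 : ℂ)))).prodMk continuous_snd
  continuous_invFun := (D.continuous_untwist.comp
    (by fun_prop : Continuous fun a : G × openUnitDisc => (a.1, -(a.2 : ℂ)))).prodMk continuous_snd

/-- The untwisting homeomorphism at a fixed parameter. -/
def untwistHomeomorphAt [IsTopologicalGroup G] (t : ℂ) : G ≃ₜ G where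
  toFun a := D.untwist t a
  invFun a := D.untwist (-t) a
  left_inv a := by simp [untwist_neg_untwist]
  right_inv a := by simp [untwist_untwist_neg]
  continuous_toFun := D.continuous_untwist.comp (by fun_prop : Continuous fun a : G => (a, t))
  continuous_invFun := D.continuous_untwist.comp (by fun_prop : Continuous fun a : G => (a, -t))

variable (Γ : Subgroup G)

/-- The projection of `G` onto its quotient by the deformed action at the parameter `t`. -/
def proj (t : ℂ) (g : G) : LatticeQuotient Γ := Quotient.mk _ (D.untwist t g)

/-- The projection of `G × Δ` onto the total space of the deformation. -/
def totalProj (a : G × openUnitDisc) : LatticeQuotient Γ × openUnitDisc :=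
  (D.proj Γ a.2 a.1, a.2)

theorem proj_zero : D.proj Γ 0 = (Quotient.mk _ : G → LatticeQuotient Γ) := by
  ext g
  simp [proj, untwist]

theorem proj_deck {γ : G} (hγ : γ ∈ Γ) (t : ℂ) (g : G) :
    D.proj Γ t (D.deck γ t g) = D.proj Γ t g := by
  rw [proj, untwist_deck]
  exact Quotient.sound ⟨⟨γ, hγ⟩, rfl⟩

theorem exists_deck_of_proj_eq {t : ℂ} {g h : G} (hgh : D.proj Γ t g = D.proj Γ t h) :
    ∃ γ ∈ Γ, D.deck γ t g = h := by
  obtain ⟨γ, hγ⟩ : ∃ γ : Γ, (γ : G) * D.untwist t g = D.untwist t h := Quotient.exact hgh.symm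
  refine ⟨γ, γ.2, ?_⟩
  rw [← D.untwist_neg_untwist t (D.deck γ t g), untwist_deck, hγ, untwist_neg_untwist]

theorem proj_surjective (t : ℂ) : Function.Surjective (D.proj Γ t) := by
  intro x
  obtain ⟨g, rfl⟩ := Quotient.exists_rep x
  exact ⟨D.untwist (-t) g, by rw [proj, untwist_untwist_neg]⟩

theorem totalProj_surjective : Function.Surjective (D.totalProj Γ) := by
  rintro ⟨x, t⟩
  obtain ⟨g, hg⟩ := D.proj_surjective Γ t x
  exact ⟨(g, t), by simp [totalProj, hg]⟩

variable [LieGroup 𝓘(ℂ, E) ω G]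

theorem contMDiff_deck (γ : G) (t : ℂ) : ContMDiff 𝓘(ℂ, E) 𝓘(ℂ, E) ω (D.deck γ t) := by
  unfold deck
  exact (contMDiff_const.mul contMDiff_id).mul contMDiff_const

theorem hasLocalDecks_proj (t : ℂ) : HasLocalDecks ℂ E (D.proj Γ t) := by
  intro a b hab
  obtain ⟨γ, hγ, h⟩ := D.exists_deck_of_proj_eq Γ hab
  exact ⟨D.deck γ t, (D.contMDiff_deck γ t).contMDiffAt, h, fun x => D.proj_deck Γ hγ t x⟩

theorem contMDiff_coe_openUnitDisc :
    ContMDiff 𝓘(ℂ, ℂ) 𝓘(ℂ, ℂ) ω (Subtype.val : openUnitDisc → ℂ) := by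
  let : ChartedSpace ℂ ℂ := chartedSpaceSelf ℂ
  exact contMDiff_subtype_val

/-- For a fixed `γ` the conjugate `conj (lam γ)` is a constant, so the action is holomorphic in `g`
and `t` together even though the untwisting map is not. -/
theorem hasLocalDecks_totalProj : HasLocalDecks ℂ (E × ℂ) (D.totalProj Γ) := by
  rintro ⟨a, t⟩ ⟨b, t'⟩ hab
  simp only [totalProj, Prod.mk.injEq] at hab
  obtain ⟨hab, rfl⟩ := hab
  obtain ⟨γ, hγ, h⟩ := D.exists_deck_of_proj_eq Γ hab
  refine ⟨fun x => (D.deck γ x.2 x.1, x.2), ?_, by simp [h], fun x => ?_⟩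
  · rw [self_prod_eq]
    refine ContMDiff.contMDiffAt (ContMDiff.prodMk ?_ contMDiff_snd)
    unfold deck
    refine (contMDiff_const.mul contMDiff_fst).mul (D.contMDiff_ψ.comp ?_)
    have h1 : ContMDiff (𝓘(ℂ, E).prod 𝓘(ℂ, ℂ)) 𝓘(ℂ, ℂ) ω
        (fun x : G × openUnitDisc => (x.2 : ℂ)) :=
      contMDiff_coe_openUnitDisc.comp contMDiff_snd
    have h2 : ContMDiff 𝓘(ℂ, ℂ) 𝓘(ℂ, ℂ) ω (fun z : ℂ => -(z * starRingEnd ℂ (D.lam γ))) := by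
      rw [contMDiff_iff_contDiff]
      fun_prop
    exact h2.comp h1
  · simp [totalProj, D.proj_deck Γ hγ]

variable [FiniteDimensional ℂ E] [T2Space G] [DiscreteTopology Γ]

theorem isLocalHomeomorph_proj (t : ℂ) : IsLocalHomeomorph (D.proj Γ t) := by
  have : IsTopologicalGroup G := isTopologicalGroup_of_complexLieGroup E G
  exact (isLocalHomeomorph_mk E Γ).comp (D.untwistHomeomorphAt t).isLocalHomeomorph

theorem isLocalHomeomorph_totalProj : IsLocalHomeomorph (D.totalProj Γ) := by
  have : IsTopologicalGroup G := isTopologicalGroup_of_complexLieGroup E G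
  have h : IsLocalHomeomorph (Prod.map (Quotient.mk _ : G → LatticeQuotient Γ)
      (id : openUnitDisc → openUnitDisc)) := by
    refine IsLocalHomeomorph.mk _ fun a => ?_
    obtain ⟨e, he, h⟩ := isLocalHomeomorph_mk E Γ a.1
    refine ⟨e.prod (OpenPartialHomeomorph.refl _), ⟨he, trivial⟩, fun x _ => ?_⟩
    simp [h, Prod.map]
  exact h.comp D.untwistHomeomorph.isLocalHomeomorph

/-- The total space is the topological product `LatticeQuotient Γ × openUnitDisc`, with charts
transported by `totalProj`; separation, properness and connectedness come from the product. Each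
fibre is returned with its projection `p` from `G`, since the obstruction to parallelisability is
computed upstairs. -/
theorem exists_deformation [ConnectedSpace G] [CompactSpace (LatticeQuotient Γ)] :
    ∃ (Y : Type u) (_ : TopologicalSpace Y) (_ : T2Space Y) (_ : SecondCountableTopology Y)
      (_ : ConnectedSpace Y) (_ : ChartedSpace (E × ℂ) Y) (_ : IsManifold 𝓘(ℂ, E × ℂ) ω Y)
      (π : Y → openUnitDisc) (ι : LatticeQuotient Γ → Y),
      IsDeformation E ℂ π openUnitDisc.centre ι ∧
      ∀ t : openUnitDisc,
        ∃ (F : Type u) (_ : TopologicalSpace F) (_ : ChartedSpace E F)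
          (_ : IsManifold 𝓘(ℂ, E) ω F) (κ : F → Y) (p : G → F),
          IsFibreEmbedding E ℂ π t κ ∧ CompactSpace F ∧ Function.Surjective p ∧
          IsLocalDiffeomorph 𝓘(ℂ, E) 𝓘(ℂ, E) ω p ∧
          (∀ γ ∈ Γ, ∀ g, p (D.deck γ t g) = p g) ∧
          ∀ g h, p g = p h → ∃ γ ∈ Γ, D.deck γ t g = h := by
  have hX2 : T2Space (LatticeQuotient Γ) := t2Space_latticeQuotient E Γ
  have hP := D.isLocalHomeomorph_totalProj Γ
  have hPs := D.totalProj_surjective Γ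
  have : IsManifold 𝓘(ℂ, E × ℂ) ω (G × openUnitDisc) := isManifold_prod_self
  have : IsManifold 𝓘(ℂ, E) ω G := inferInstance
  let cY : ChartedSpace (E × ℂ) (LatticeQuotient Γ × openUnitDisc) := hP.chartedSpace hPs
  have hYm : IsManifold 𝓘(ℂ, E × ℂ) ω (LatticeQuotient Γ × openUnitDisc) :=
    (D.hasLocalDecks_totalProj Γ).isManifold hP hPs
  have hPd : IsLocalDiffeomorph 𝓘(ℂ, E × ℂ) 𝓘(ℂ, E × ℂ) ω (D.totalProj Γ) :=
    (D.hasLocalDecks_totalProj Γ).isLocalDiffeomorph hP hPs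
  have hsc : SecondCountableTopology (LatticeQuotient Γ) := by
    have : ProperSpace E := FiniteDimensional.proper ℂ E
    exact ChartedSpace.secondCountable_of_sigmaCompact E _
  have hconn : ConnectedSpace (LatticeQuotient Γ) := by
    infer_instance
  have hdisc : ConnectedSpace openUnitDisc :=
    isConnected_iff_connectedSpace.1 (Metric.isConnected_ball one_pos)
  -- The charted structure `cF` is arbitrary, so that the claim covers both the original structure
  -- of `Γ \ G` at the centre and the deformed ones.
  have hfib : ∀ (t : openUnitDisc) (cF : ChartedSpace E (LatticeQuotient Γ)),
      IsManifold 𝓘(ℂ, E) ω (LatticeQuotient Γ) →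
      IsLocalDiffeomorph 𝓘(ℂ, E) 𝓘(ℂ, E) ω (D.proj Γ t) →
      IsFibreEmbedding E ℂ (Y := LatticeQuotient Γ × openUnitDisc) Prod.snd t
        (fun x : LatticeQuotient Γ => (x, t)) := by
    intro t cF hF hpt
    refine ⟨⟨isImmersion_of_slice hpt (D.proj_surjective Γ t) hPd t (by fun_prop)
      fun x => rfl, ?_⟩, ?_⟩
    · exact isEmbedding_prodMkLeft t
    · ext ⟨x, s⟩
      simp [eq_comm]
  refine ⟨LatticeQuotient Γ × openUnitDisc, inferInstance, inferInstance, inferInstance,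
    inferInstance, cY, hYm, Prod.snd, fun x => (x, openUnitDisc.centre), ⟨?_, ?_, ?_⟩, fun t => ?_⟩
  · exact isSubmersion_of_slices hPd hPs continuous_snd fun a => rfl
  · exact isProperMap_snd_of_compactSpace
  · refine hfib openUnitDisc.centre _ inferInstance ?_
    have h0 : D.proj Γ ((openUnitDisc.centre : openUnitDisc) : ℂ) =
        (Quotient.mk _ : G → LatticeQuotient Γ) := D.proj_zero Γ
    have h1 := D.hasLocalDecks_proj Γ ((openUnitDisc.centre : openUnitDisc) : ℂ)
    rw [h0] at h1 ⊢
    exact h1.isLocalDiffeomorph (isLocalHomeomorph_mk E Γ) Quotient.mk_surjective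
  · have hp := D.isLocalHomeomorph_proj Γ t
    have hps := D.proj_surjective Γ t
    let cF : ChartedSpace E (LatticeQuotient Γ) := hp.chartedSpace hps
    have hFm := (D.hasLocalDecks_proj Γ t).isManifold hp hps
    have hpd := (D.hasLocalDecks_proj Γ t).isLocalDiffeomorph hp hps
    exact ⟨LatticeQuotient Γ, inferInstance, cF, hFm, _, D.proj Γ t, hfib t cF hFm hpd,
      inferInstance, hps, hpd, fun γ hγ g => D.proj_deck Γ hγ t g,
      fun g h => D.exists_deck_of_proj_eq Γ⟩

end TwistData

end TwistedFamily

/-! ### The adjoint representation in the chart at the identity. -/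

namespace LieGroupChart

variable (E : Type v) [NormedAddCommGroup E] [NormedSpace ℂ E]
  (G : Type u) [TopologicalSpace G] [ChartedSpace E G] [Group G]

/-- The preferred chart at the identity. -/
abbrev unitChart : OpenPartialHomeomorph G E := chartAt E (1 : G)

/-- The coordinate of the identity in the preferred chart. -/
abbrev unitPt : E := unitChart E G 1

variable {G}

/-- The adjoint representation, written in the preferred chart at the identity. -/
noncomputable def Ad (g : G) : E →L[ℂ] E :=
  fderiv ℂ (fun w => unitChart E G (g * (unitChart E G).symm w * g⁻¹)) (unitPt E G)

variable (G)

/-- The multiplication in the preferred chart at the identity. -/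
noncomputable def locMul (a : E × E) : E :=
  unitChart E G ((unitChart E G).symm a.1 * (unitChart E G).symm a.2)

@[simp] theorem unitChart_symm_unitPt : (unitChart E G).symm (unitPt E G) = 1 :=
  (unitChart E G).left_inv (mem_chart_source E 1)

theorem unitPt_mem_target : unitPt E G ∈ (unitChart E G).target := mem_chart_target E 1

theorem unitPt_eventually_mem_target : ∀ᶠ y in 𝓝 (unitPt E G), y ∈ (unitChart E G).target :=
  (unitChart E G).open_target.mem_nhds (unitPt_mem_target E G)

variable [LieGroup 𝓘(ℂ, E) ω G]

variable {E G} in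
theorem contMDiffAt_unitChart {g : G} (hg : g ∈ (unitChart E G).source) :
    ContMDiffAt 𝓘(ℂ, E) 𝓘(ℂ, E) ω (unitChart E G) g :=
  (contMDiffOn_chart (I := 𝓘(ℂ, E)) (n := ω) (x := (1 : G))).contMDiffAt
    ((unitChart E G).open_source.mem_nhds hg)

variable {E G} in
theorem contMDiffAt_unitChart_symm {y : E} (hy : y ∈ (unitChart E G).target) :
    ContMDiffAt 𝓘(ℂ, E) 𝓘(ℂ, E) ω (unitChart E G).symm y :=
  (contMDiffOn_chart_symm (I := 𝓘(ℂ, E)) (n := ω) (x := (1 : G))).contMDiffAt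
    ((unitChart E G).open_target.mem_nhds hy)

theorem contDiffAt_locMul {y w : E} (hy : y ∈ (unitChart E G).target)
    (hw : w ∈ (unitChart E G).target)
    (h : (unitChart E G).symm y * (unitChart E G).symm w ∈ (unitChart E G).source) :
    ContDiffAt ℂ ω (locMul E G) (y, w) := by
  rw [← contMDiffAt_iff_contDiffAt]
  have h1 : ContMDiffAt 𝓘(ℂ, E × E) 𝓘(ℂ, E) ω (fun a : E × E => (unitChart E G).symm a.1) (y, w) :=
    ContMDiffAt.comp (I' := 𝓘(ℂ, E)) (g := (unitChart E G).symm) (f := Prod.fst) (y, w)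
      (contMDiffAt_unitChart_symm hy) contDiffAt_fst.contMDiffAt
  have h2 : ContMDiffAt 𝓘(ℂ, E × E) 𝓘(ℂ, E) ω (fun a : E × E => (unitChart E G).symm a.2) (y, w) :=
    ContMDiffAt.comp (I' := 𝓘(ℂ, E)) (g := (unitChart E G).symm) (f := Prod.snd) (y, w)
      (contMDiffAt_unitChart_symm hw) contDiffAt_snd.contMDiffAt
  exact ContMDiffAt.comp (g := unitChart E G) (y, w) (contMDiffAt_unitChart h) (h1.mul h2)

theorem contDiffAt_locMul_left {y : E} (hy : y ∈ (unitChart E G).target) :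
    ContDiffAt ℂ ω (locMul E G) (y, unitPt E G) :=
  contDiffAt_locMul E G hy (unitPt_mem_target E G)
    (by simpa using (unitChart E G).map_target hy)

theorem contDiffAt_locMul_right {y : E} (hy : y ∈ (unitChart E G).target) :
    ContDiffAt ℂ ω (locMul E G) (unitPt E G, y) :=
  contDiffAt_locMul E G (unitPt_mem_target E G) hy
    (by simpa using (unitChart E G).map_target hy)

/-- Conjugation is jointly holomorphic in the group element and the conjugated point, so its partial
derivative at the identity depends holomorphically on the group element. -/
theorem contMDiffAt_Ad (g : G) :
    ContMDiffAt 𝓘(ℂ, E) 𝓘(ℂ, E →L[ℂ] E) ω (fun g => Ad E g) g := by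
  set c := chartAt E g with hc
  have hK : ContDiffAt ℂ ω (Function.uncurry fun z w : E =>
      unitChart E G (c.symm z * (unitChart E G).symm w * (c.symm z)⁻¹)) (c g, unitPt E G) := by
    rw [← contMDiffAt_iff_contDiffAt]
    have h1 : ContMDiffAt 𝓘(ℂ, E × E) 𝓘(ℂ, E) ω (fun a : E × E => c.symm a.1)
        (c g, unitPt E G) :=
      ContMDiffAt.comp (I' := 𝓘(ℂ, E)) (g := c.symm) (f := Prod.fst) (c g, unitPt E G)
        ((contMDiffOn_chart_symm (I := 𝓘(ℂ, E)) (n := ω) (x := g)).contMDiffAt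
          (c.open_target.mem_nhds (mem_chart_target E g))) contDiffAt_fst.contMDiffAt
    have h2 : ContMDiffAt 𝓘(ℂ, E × E) 𝓘(ℂ, E) ω (fun a : E × E => (unitChart E G).symm a.2)
        (c g, unitPt E G) :=
      ContMDiffAt.comp (I' := 𝓘(ℂ, E)) (g := (unitChart E G).symm) (f := Prod.snd)
        (c g, unitPt E G)
        (contMDiffAt_unitChart_symm (unitPt_mem_target E G)) contDiffAt_snd.contMDiffAt
    refine ContMDiffAt.comp (g := unitChart E G) (c g, unitPt E G) (contMDiffAt_unitChart ?_)
      ((h1.mul h2).mul h1.inv)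
    simp
  have h1 : ContDiffAt ℂ ω (fun z : E => Ad E (c.symm z)) (c g) :=
    hK.fderiv (g := fun _ => unitPt E G) contDiffAt_const (m := ω) (by simp)
  have h2 : ContMDiffAt 𝓘(ℂ, E) 𝓘(ℂ, E) ω c g :=
    (contMDiffOn_chart (I := 𝓘(ℂ, E)) (n := ω) (x := g)).contMDiffAt
      (c.open_source.mem_nhds (mem_chart_source E g))
  refine (ContMDiffAt.comp (g := fun z : E => Ad E (c.symm z)) g h1.contMDiffAt
    h2).congr_of_eventuallyEq ?_
  filter_upwards [c.open_source.mem_nhds (mem_chart_source E g)] with x hx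
  simp [c.left_inv hx]

theorem contDiffAt_conj_unitPt (g : G) : ContDiffAt ℂ ω
    (fun w => unitChart E G (g * (unitChart E G).symm w * g⁻¹)) (unitPt E G) := by
  rw [← contMDiffAt_iff_contDiffAt]
  refine ContMDiffAt.comp (g := unitChart E G) _ (contMDiffAt_unitChart (by simp)) ?_
  exact (contMDiffAt_const.mul (contMDiffAt_unitChart_symm (unitPt_mem_target E G))).mul
    contMDiffAt_const

theorem hasFDerivAt_Ad (g : G) : HasFDerivAt
    (fun w => unitChart E G (g * (unitChart E G).symm w * g⁻¹)) (Ad E g) (unitPt E G) :=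
  ((contDiffAt_conj_unitPt E G g).differentiableAt (by simp)).hasFDerivAt

variable {G} in
/-- Near the identity coordinate, the elements stay in the source of the unit chart after
conjugation. -/
theorem eventually_conj_mem_source (g : G) : ∀ᶠ w in 𝓝 (unitPt E G),
    g * (unitChart E G).symm w * g⁻¹ ∈ (unitChart E G).source := by
  have : IsTopologicalGroup G := isTopologicalGroup_of_complexLieGroup E G
  have h : ContinuousAt (fun w => g * (unitChart E G).symm w * g⁻¹) (unitPt E G) :=
    (continuousAt_const.mul ((unitChart E G).symm.continuousAt (unitPt_mem_target E G))).mul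
      continuousAt_const
  apply h.eventually_mem
  apply (unitChart E G).open_source.mem_nhds
  simp

theorem Ad_mul (g h : G) : Ad E (g * h) = (Ad E g).comp (Ad E h) := by
  have h1 := hasFDerivAt_Ad E G g
  have h2 := hasFDerivAt_Ad E G h
  have h3 : unitChart E G (h * (unitChart E G).symm (unitPt E G) * h⁻¹) = unitPt E G := by simp
  rw [← h3] at h1
  have h4 := h1.comp (unitPt E G) h2
  refine (h4.congr_of_eventuallyEq ?_).fderiv
  filter_upwards [eventually_conj_mem_source E h] with w hw
  simp only [Function.comp_apply]
  rw [(unitChart E G).left_inv hw]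
  simp [mul_assoc]

@[simp] theorem Ad_one : Ad E (1 : G) = ContinuousLinearMap.id ℂ E := by
  have : HasFDerivAt (fun w : E => w) (ContinuousLinearMap.id ℂ E) (unitPt E G) :=
    hasFDerivAt_id _
  refine (this.congr_of_eventuallyEq ?_).fderiv
  filter_upwards [unitPt_eventually_mem_target E G] with w hw
  simp [(unitChart E G).right_inv hw]

end LieGroupChart

/-! ### Derivatives of translations and of `Ad` at the identity. -/

namespace LieGroupChart

variable (E : Type v) [NormedAddCommGroup E] [NormedSpace ℂ E]
  (G : Type u) [TopologicalSpace G] [ChartedSpace E G] [Group G] [LieGroup 𝓘(ℂ, E) ω G]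

/-- The derivative at the identity of the left translation by the point with coordinate `y`. -/
noncomputable def leftDeriv (y : E) : E →L[ℂ] E :=
  fderiv ℂ (fun w => locMul E G (y, w)) (unitPt E G)

/-- The derivative at the identity of the right translation by the point with coordinate `y`. -/
noncomputable def rightDeriv (y : E) : E →L[ℂ] E :=
  fderiv ℂ (fun w => locMul E G (w, y)) (unitPt E G)

theorem hasFDerivAt_leftDeriv {y : E} (hy : y ∈ (unitChart E G).target) :
    HasFDerivAt (fun w => locMul E G (y, w)) (leftDeriv E G y) (unitPt E G) := by
  have h1 := ((contDiffAt_locMul_left E G hy).differentiableAt (by simp)).hasFDerivAt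
  exact (h1.comp (unitPt E G)
    (hasFDerivAt_prodMk_right (𝕜 := ℂ) y (unitPt E G))).differentiableAt.hasFDerivAt

theorem leftDeriv_eq {y : E} (hy : y ∈ (unitChart E G).target) :
    leftDeriv E G y = (fderiv ℂ (locMul E G) (y, unitPt E G)).comp
      (ContinuousLinearMap.inr ℂ E E) := by
  have h1 := ((contDiffAt_locMul_left E G hy).differentiableAt (by simp)).hasFDerivAt
  exact (h1.comp (unitPt E G) (hasFDerivAt_prodMk_right (𝕜 := ℂ) y (unitPt E G))).fderiv

theorem hasFDerivAt_rightDeriv {y : E} (hy : y ∈ (unitChart E G).target) :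
    HasFDerivAt (fun w => locMul E G (w, y)) (rightDeriv E G y) (unitPt E G) := by
  have h1 := ((contDiffAt_locMul_right E G hy).differentiableAt (by simp)).hasFDerivAt
  exact (h1.comp (unitPt E G)
    (hasFDerivAt_prodMk_left (𝕜 := ℂ) (unitPt E G) y)).differentiableAt.hasFDerivAt

theorem rightDeriv_eq {y : E} (hy : y ∈ (unitChart E G).target) :
    rightDeriv E G y = (fderiv ℂ (locMul E G) (unitPt E G, y)).comp
      (ContinuousLinearMap.inl ℂ E E) := by
  have h1 := ((contDiffAt_locMul_right E G hy).differentiableAt (by simp)).hasFDerivAt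
  exact (h1.comp (unitPt E G) (hasFDerivAt_prodMk_left (𝕜 := ℂ) (unitPt E G) y)).fderiv

@[simp] theorem leftDeriv_unitPt : leftDeriv E G (unitPt E G) = ContinuousLinearMap.id ℂ E := by
  have : HasFDerivAt (fun w : E => w) (ContinuousLinearMap.id ℂ E) (unitPt E G) :=
    hasFDerivAt_id _
  refine (this.congr_of_eventuallyEq ?_).fderiv
  filter_upwards [unitPt_eventually_mem_target E G] with w hw
  simp [locMul, (unitChart E G).right_inv hw]

@[simp] theorem rightDeriv_unitPt : rightDeriv E G (unitPt E G) = ContinuousLinearMap.id ℂ E := by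
  have : HasFDerivAt (fun w : E => w) (ContinuousLinearMap.id ℂ E) (unitPt E G) :=
    hasFDerivAt_id _
  refine (this.congr_of_eventuallyEq ?_).fderiv
  filter_upwards [unitPt_eventually_mem_target E G] with w hw
  simp [locMul, (unitChart E G).right_inv hw]

/-- The second derivative of the multiplication at the identity. -/
noncomputable abbrev sndDeriv : E × E →L[ℂ] E × E →L[ℂ] E :=
  fderiv ℂ (fderiv ℂ (locMul E G)) (unitPt E G, unitPt E G)

theorem hasFDerivAt_fderiv_locMul : HasFDerivAt (fderiv ℂ (locMul E G)) (sndDeriv E G)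
    (unitPt E G, unitPt E G) := by
  have h := contDiffAt_locMul_left E G (unitPt_mem_target E G)
  have h1 : ContDiffAt ℂ ω (fderiv ℂ (locMul E G)) (unitPt E G, unitPt E G) :=
    h.fderiv_right (by simp)
  exact (h1.differentiableAt (by simp)).hasFDerivAt

theorem hasFDerivAt_leftDeriv_apply (b : E) : HasFDerivAt (fun y => leftDeriv E G y b)
    (((sndDeriv E G).comp (ContinuousLinearMap.inl ℂ E E)).flip (0, b)) (unitPt E G) := by
  have h1 := HasFDerivAt.comp (f := fun y => (y, unitPt E G)) (unitPt E G)
    (hasFDerivAt_fderiv_locMul E G)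
    (hasFDerivAt_prodMk_left (𝕜 := ℂ) (unitPt E G) (unitPt E G))
  have h2 := h1.clm_apply (hasFDerivAt_const ((0 : E), b) (unitPt E G))
  refine (h2.congr_of_eventuallyEq ?_).congr_fderiv ?_
  · filter_upwards [unitPt_eventually_mem_target E G] with y hy
    simp [leftDeriv_eq E G hy]
  · ext a; simp

theorem hasFDerivAt_rightDeriv_family : HasFDerivAt (fun y => rightDeriv E G y)
    (((ContinuousLinearMap.compL ℂ E (E × E) E).flip (ContinuousLinearMap.inl ℂ E E)).comp
      ((sndDeriv E G).comp (ContinuousLinearMap.inr ℂ E E))) (unitPt E G) := by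
  have h1 := HasFDerivAt.comp (f := fun y => (unitPt E G, y)) (unitPt E G)
    (hasFDerivAt_fderiv_locMul E G)
    (hasFDerivAt_prodMk_right (𝕜 := ℂ) (unitPt E G) (unitPt E G))
  have h2 := (((ContinuousLinearMap.compL ℂ E (E × E) E).flip
    (ContinuousLinearMap.inl ℂ E E)).hasFDerivAt).comp (unitPt E G) h1
  refine h2.congr_of_eventuallyEq ?_
  filter_upwards [unitPt_eventually_mem_target E G] with y hy
  simp [rightDeriv_eq E G hy]

/-- Differentiate `g w = (g w g⁻¹) g` in `w` at the identity. -/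
theorem leftDeriv_eq_rightDeriv_comp_Ad {y : E} (hy : y ∈ (unitChart E G).target) :
    leftDeriv E G y = (rightDeriv E G y).comp (Ad E ((unitChart E G).symm y)) := by
  set g := (unitChart E G).symm y with hg
  have h1 := hasFDerivAt_Ad E G g
  have h2 := hasFDerivAt_rightDeriv E G hy
  have h3 : unitChart E G (g * (unitChart E G).symm (unitPt E G) * g⁻¹) = unitPt E G := by simp
  rw [← h3] at h2
  refine ((h2.comp (unitPt E G) h1).congr_of_eventuallyEq ?_).fderiv
  filter_upwards [eventually_conj_mem_source E g] with w hw
  simp only [Function.comp_apply, locMul]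
  rw [(unitChart E G).left_inv hw]
  simp [hg]

theorem differentiableAt_Ad_apply (x : E) :
    DifferentiableAt ℂ (fun y => Ad E ((unitChart E G).symm y) x) (unitPt E G) := by
  have h1 : ContMDiffAt 𝓘(ℂ, E) 𝓘(ℂ, E →L[ℂ] E) ω
      (fun y => Ad E ((unitChart E G).symm y)) (unitPt E G) :=
    ContMDiffAt.comp (g := fun g : G => Ad E g) _ (contMDiffAt_Ad E G _)
      (contMDiffAt_unitChart_symm (unitPt_mem_target E G))
  have h2 := h1.contDiffAt.differentiableAt (by simp)
  exact h2.clm_apply (differentiableAt_const x)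

/-- Differentiating `leftDeriv y = rightDeriv y ∘ Ad y` at the identity expresses the derivative of
`Ad` by mixed second derivatives of the product; their symmetry puts the result in commutator form.
-/
theorem fderiv_Ad_apply (x v : E) :
    fderiv ℂ (fun y => Ad E ((unitChart E G).symm y) x) (unitPt E G) v =
      sndDeriv E G (v, 0) (0, x) - sndDeriv E G (x, 0) (0, v) := by
  have hsymm : IsSymmSndFDerivAt ℂ (locMul E G) (unitPt E G, unitPt E G) :=
    (contDiffAt_locMul_left E G (unitPt_mem_target E G)).isSymmSndFDerivAt_of_omega
  have h1 := (hasFDerivAt_rightDeriv_family E G).clm_apply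
    (differentiableAt_Ad_apply E G x).hasFDerivAt
  have h2 : HasFDerivAt (fun y => leftDeriv E G y x) _ (unitPt E G) :=
    h1.congr_of_eventuallyEq (by
      filter_upwards [unitPt_eventually_mem_target E G] with y hy
      simp [leftDeriv_eq_rightDeriv_comp_Ad E G hy])
  have h3 := DFunLike.congr_fun ((hasFDerivAt_leftDeriv_apply E G x).unique h2) v
  have h4 : sndDeriv E G (0, v) (x, 0) = sndDeriv E G (x, 0) (0, v) := hsymm _ _
  simp at h3
  rw [h4] at h3
  rw [h3]
  abel

end LieGroupChart

/-! ### Comparison with the Lie bracket of left-invariant fields. -/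

namespace LieGroupChart

open VectorField

variable (E : Type v) [NormedAddCommGroup E] [NormedSpace ℂ E]
  (G : Type u) [TopologicalSpace G] [ChartedSpace E G] [Group G]

/-- The Lie bracket of the Lie algebra of `G`, on the model space. -/
noncomputable def bracket (v w : E) : E :=
  @Bracket.bracket (GroupLieAlgebra 𝓘(ℂ, E) G) (GroupLieAlgebra 𝓘(ℂ, E) G) _ v w

variable [LieGroup 𝓘(ℂ, E) ω G]

/-- The tangent space at a point is identified with `E` through the preferred chart there, so the
chart has identity derivative at its own centre. -/
theorem mfderiv_unitChart_one :
    (mfderiv 𝓘(ℂ, E) 𝓘(ℂ, E) (unitChart E G) (1 : G) : E →L[ℂ] E) =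
      ContinuousLinearMap.id ℂ E := by
  rw [mfderiv_chartAt_eq_tangentCoordChange (mem_chart_source E (1 : G))]
  ext v
  exact tangentCoordChange_self (mem_extChartAt_source (I := 𝓘(ℂ, E)) (1 : G))

theorem hasMFDerivAt_unitChart_symm :
    HasMFDerivAt 𝓘(ℂ, E) 𝓘(ℂ, E) (unitChart E G).symm (unitPt E G)
      (ContinuousLinearMap.id ℂ E) := by
  have h1 : MDifferentiableAt 𝓘(ℂ, E) 𝓘(ℂ, E) (unitChart E G).symm (unitPt E G) :=
    (contMDiffAt_unitChart_symm (unitPt_mem_target E G)).mdifferentiableAt (by simp)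
  have h2 : HasMFDerivAt 𝓘(ℂ, E) 𝓘(ℂ, E) (unitChart E G) ((unitChart E G).symm (unitPt E G))
      (ContinuousLinearMap.id ℂ E) := by
    rw [unitChart_symm_unitPt]
    have := ((contMDiffAt_unitChart (mem_chart_source E (1 : G))).mdifferentiableAt
      (by simp)).hasMFDerivAt
    rwa [mfderiv_unitChart_one E G] at this
  have h3 := h2.comp (unitPt E G) h1.hasMFDerivAt
  have h4 : HasMFDerivAt 𝓘(ℂ, E) 𝓘(ℂ, E) ((unitChart E G) ∘ (unitChart E G).symm) (unitPt E G)
      (ContinuousLinearMap.id ℂ E) := by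
    refine (hasMFDerivAt_id (I := 𝓘(ℂ, E)) (unitPt E G)).congr_of_eventuallyEq ?_
    filter_upwards [unitPt_eventually_mem_target E G] with w hw
    simp [(unitChart E G).right_inv hw]
  have h5 := hasMFDerivAt_unique h3 h4
  have h6 := h1.hasMFDerivAt
  exact h5 ▸ h6

theorem mfderiv_mul_left_comp {y : E} (hy : y ∈ (unitChart E G).target) :
    (mfderiv 𝓘(ℂ, E) 𝓘(ℂ, E) (fun h : G => (unitChart E G).symm y * h) (1 : G) : E →L[ℂ] E) =
      (mfderiv 𝓘(ℂ, E) 𝓘(ℂ, E) (unitChart E G).symm y : E →L[ℂ] E).comp (leftDeriv E G y) := by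
  set g := (unitChart E G).symm y with hg
  have hA : HasMFDerivAt 𝓘(ℂ, E) 𝓘(ℂ, E) (fun h : G => g * h) ((unitChart E G).symm (unitPt E G))
      (mfderiv 𝓘(ℂ, E) 𝓘(ℂ, E) (fun h : G => g * h) (1 : G) : E →L[ℂ] E) := by
    rw [unitChart_symm_unitPt]
    exact ((contMDiff_mul_left (I := 𝓘(ℂ, E)) (n := ω) (a := g)).mdifferentiableAt
      (by simp)).hasMFDerivAt
  have hC : HasMFDerivAt 𝓘(ℂ, E) 𝓘(ℂ, E) (unitChart E G).symm (locMul E G (y, unitPt E G))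
      (mfderiv 𝓘(ℂ, E) 𝓘(ℂ, E) (unitChart E G).symm y : E →L[ℂ] E) := by
    have : locMul E G (y, unitPt E G) = y := by
      simp [locMul, (unitChart E G).right_inv hy]
    rw [this]
    exact ((contMDiffAt_unitChart_symm hy).mdifferentiableAt (by simp)).hasMFDerivAt
  have hL := (hasFDerivAt_leftDeriv E G hy).hasMFDerivAt
  have h1 := hA.comp (unitPt E G) (hasMFDerivAt_unitChart_symm E G)
  have h2 := hC.comp (unitPt E G) hL
  have h3 := hasMFDerivAt_unique (h1.congr_of_eventuallyEq (f₁ := fun w =>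
    (unitChart E G).symm (locMul E G (y, w))) ?_) h2
  · exact h3
  · have : IsTopologicalGroup G := isTopologicalGroup_of_complexLieGroup E G
    have hc : ContinuousAt (fun w => g * (unitChart E G).symm w) (unitPt E G) :=
      continuousAt_const.mul ((unitChart E G).symm.continuousAt (unitPt_mem_target E G))
    have h4 : ∀ᶠ w in 𝓝 (unitPt E G), g * (unitChart E G).symm w ∈ (unitChart E G).source := by
      apply hc.eventually_mem
      apply (unitChart E G).open_source.mem_nhds
      simpa using (unitChart E G).map_target hy
    filter_upwards [h4] with w hw
    simp only [locMul, Function.comp_apply]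
    exact (unitChart E G).left_inv hw

theorem mpullbackWithin_mulInvariantVectorField {y : E} (hy : y ∈ (unitChart E G).target)
    (v : GroupLieAlgebra 𝓘(ℂ, E) G) :
    mpullbackWithin 𝓘(ℂ, E) 𝓘(ℂ, E) (extChartAt 𝓘(ℂ, E) (1 : G)).symm
      (mulInvariantVectorField v) (Set.range 𝓘(ℂ, E)) y = leftDeriv E G y v := by
  have hy' : y ∈ (extChartAt 𝓘(ℂ, E) (1 : G)).target := by simpa [mfld_simps] using hy
  rw [mpullbackWithin_apply]
  refine (isInvertible_mfderivWithin_extChartAt_symm hy').inverse_apply_eq.2 ?_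
  have := mfderiv_mul_left_comp E G hy
  simp only [modelWithCornersSelf_coe, Set.range_id, mfderivWithin_univ]
  exact DFunLike.congr_fun this v

/-- The left-invariant vector field with value `v` at the identity, in the preferred chart. -/
noncomputable def chartField (v : E) : E → E :=
  mpullbackWithin 𝓘(ℂ, E) 𝓘(ℂ, E) (extChartAt 𝓘(ℂ, E) (1 : G)).symm
      (mulInvariantVectorField (G := G) (I := 𝓘(ℂ, E)) v) (Set.range 𝓘(ℂ, E))

/-- In the chart the left-invariant field with value `v` is `y ↦ leftDeriv y v`, and the bracket of
two such fields at the identity is computed from their first derivatives. -/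
theorem bracket_eq (v w : E) :
    bracket E G v w = sndDeriv E G (v, 0) (0, w) - sndDeriv E G (w, 0) (0, v) := by
  have hev (v : E) : chartField E G v =ᶠ[𝓝 (unitPt E G)] fun y => leftDeriv E G y v := by
    filter_upwards [unitPt_eventually_mem_target E G] with y hy
    exact mpullbackWithin_mulInvariantVectorField E G hy v
  -- Abstracting the derivative of the chart as `L : E →L[ℂ] E` frees it from its dependent type, so
  -- that it can be replaced by the identity.
  have h1 : ∀ L : E →L[ℂ] E, L = mfderiv 𝓘(ℂ, E) 𝓘(ℂ, E) (unitChart E G) (1 : G) →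
      bracket E G v w = L.inverse (lieBracket ℂ (fun y => leftDeriv E G y v)
        (fun y => leftDeriv E G y w) (unitPt E G)) := by
    intro L hL
    rw [← (hev v).lieBracket_vectorField_eq (hev w), ← lieBracketWithin_univ]
    have hset : (Set.univ : Set E) =
        (extChartAt 𝓘(ℂ, E) (1 : G)).symm ⁻¹' Set.univ ∩ Set.range 𝓘(ℂ, E) := by simp
    rw [hset, hL]
    rfl
  rw [h1 _ (mfderiv_unitChart_one E G).symm, ContinuousLinearMap.inverse_id, lieBracket_eq]
  simp [(hasFDerivAt_leftDeriv_apply E G _).fderiv]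

theorem fderiv_Ad_apply_eq_bracket (x v : E) :
    fderiv ℂ (fun y => Ad E ((unitChart E G).symm y) x) (unitPt E G) v = bracket E G v x := by
  rw [fderiv_Ad_apply, bracket_eq]

end LieGroupChart

/-! ### Coefficients of the coadjoint representation. -/

namespace LieGroupChart

variable {E : Type v} [NormedAddCommGroup E] [NormedSpace ℂ E]
  {G : Type u} [TopologicalSpace G] [ChartedSpace E G] [Group G] [LieGroup 𝓘(ℂ, E) ω G]

theorem differentiableAt_comp_mul_right {V : Type*} [NormedAddCommGroup V] [NormedSpace ℂ V]
    {f : G → V} (hf : MDifferentiable 𝓘(ℂ, E) 𝓘(ℂ, V) f) (g : G) {w : E}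
    (hw : w ∈ (unitChart E G).target) :
    DifferentiableAt ℂ (fun w => f ((unitChart E G).symm w * g)) w := by
  rw [← mdifferentiableAt_iff_differentiableAt]
  have h1 : ContMDiffAt 𝓘(ℂ, E) 𝓘(ℂ, E) ω (fun w => (unitChart E G).symm w * g) w :=
    (contMDiffAt_unitChart_symm hw).mul contMDiffAt_const
  exact MDifferentiableAt.comp w (hf _) (h1.mdifferentiableAt (by simp))

/-- A holomorphic function on a connected complex Lie group is constant if its derivatives along
right-invariant fields vanish. -/
theorem eq_of_fderiv_mul_right_eq_zero [ConnectedSpace G] {V : Type*} [NormedAddCommGroup V]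
    [NormedSpace ℂ V] {f : G → V} (hf : MDifferentiable 𝓘(ℂ, E) 𝓘(ℂ, V) f)
    (h0 : ∀ g, fderiv ℂ (fun w => f ((unitChart E G).symm w * g)) (unitPt E G) = 0) (a b : G) :
    f a = f b := by
  have : IsTopologicalGroup G := isTopologicalGroup_of_complexLieGroup E G
  have hder : ∀ g, ∀ w₀ ∈ (unitChart E G).target,
      fderiv ℂ (fun w => f ((unitChart E G).symm w * g)) w₀ = 0 := by
    intro g w₀ hw₀
    -- The hypothesis concerns the identity only. Writing `w * g = (w * k⁻¹) * (k * g)` moves the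
    -- base point `w₀` there, at the price of replacing `g` by `k * g`.
    set k := (unitChart E G).symm w₀ with hk
    have hj : ContMDiffAt 𝓘(ℂ, E) 𝓘(ℂ, E) ω (fun w => (unitChart E G).symm w * k⁻¹) w₀ :=
      (contMDiffAt_unitChart_symm hw₀).mul contMDiffAt_const
    have hj1 : (unitChart E G).symm w₀ * k⁻¹ = 1 := by simp [hk]
    have hj2 : ContMDiffAt 𝓘(ℂ, E) 𝓘(ℂ, E) ω
        (fun w => unitChart E G ((unitChart E G).symm w * k⁻¹)) w₀ :=
      ContMDiffAt.comp (g := unitChart E G) w₀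
        (contMDiffAt_unitChart (by rw [hj1]; exact mem_chart_source E 1)) hj
    have hj3 := (hj2.contDiffAt.differentiableAt (by simp)).hasFDerivAt
    have hF := (differentiableAt_comp_mul_right hf (k * g) (unitPt_mem_target E G)).hasFDerivAt
    have hj4 : unitPt E G = unitChart E G ((unitChart E G).symm w₀ * k⁻¹) := by rw [hj1]
    rw [h0, hj4] at hF
    have hcomp := HasFDerivAt.comp (f := fun w => unitChart E G ((unitChart E G).symm w * k⁻¹))
      w₀ hF hj3
    rw [ContinuousLinearMap.zero_comp] at hcomp
    refine (hcomp.congr_of_eventuallyEq ?_).fderiv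
    have hs : ∀ᶠ w in 𝓝 w₀, (unitChart E G).symm w * k⁻¹ ∈ (unitChart E G).source := by
      apply hj.continuousAt.eventually_mem
      apply (unitChart E G).open_source.mem_nhds
      rw [hj1]; exact mem_chart_source E 1
    filter_upwards [hs] with w hw
    simp only [Function.comp_apply]
    rw [(unitChart E G).left_inv hw]
    simp [mul_assoc]
  refine IsLocallyConstant.apply_eq_of_preconnectedSpace
    ((IsLocallyConstant.iff_eventually_eq f).2 fun g => ?_) a b
  obtain ⟨r, hr, hball⟩ := Metric.isOpen_iff.1 (unitChart E G).open_target _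
    (unitPt_mem_target E G)
  have hconst : ∀ w ∈ Metric.ball (unitPt E G) r, f ((unitChart E G).symm w * g) =
      f ((unitChart E G).symm (unitPt E G) * g) := by
    intro w hw
    refine Metric.isOpen_ball.is_const_of_fderiv_eq_zero (𝕜 := ℂ)
      (f := fun w => f ((unitChart E G).symm w * g))
      (convex_ball _ _).isPreconnected (fun x hx => ?_) (fun x hx => hder g x (hball hx)) hw
      (Metric.mem_ball_self hr)
    exact (differentiableAt_comp_mul_right hf g (hball hx)).differentiableWithinAt
  have hc : ContinuousAt (fun x : G => x * g⁻¹) g := by fun_prop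
  have h1 : ∀ᶠ x in 𝓝 g, x * g⁻¹ ∈ (unitChart E G).source := by
    apply hc.eventually_mem
    apply (unitChart E G).open_source.mem_nhds
    simp
  have h2 : ∀ᶠ x in 𝓝 g, unitChart E G (x * g⁻¹) ∈ Metric.ball (unitPt E G) r := by
    have : ContinuousAt (fun x : G => unitChart E G (x * g⁻¹)) g :=
      ContinuousAt.comp (g := unitChart E G)
        ((unitChart E G).continuousAt (by simp)) hc
    apply this.eventually_mem
    apply Metric.isOpen_ball.mem_nhds
    simpa using hr
  filter_upwards [h1, h2] with x hx1 hx2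
  have := hconst _ hx2
  rw [(unitChart E G).left_inv hx1] at this
  simpa using this

theorem contMDiff_apply_Ad (ℓ : E →L[ℂ] ℂ) (x : E) :
    ContMDiff 𝓘(ℂ, E) 𝓘(ℂ, ℂ) ω (fun g : G => ℓ (Ad E g x)) := by
  intro g
  have h1 := (contMDiffAt_Ad E G g)
  have h2 : ContMDiffAt 𝓘(ℂ, E →L[ℂ] E) 𝓘(ℂ, ℂ) ω (fun A : E →L[ℂ] E => ℓ (A x)) (Ad E g) :=
    ((ℓ.comp (ContinuousLinearMap.apply ℂ E x)).contDiff).contDiffAt.contMDiffAt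
  exact (ContMDiffAt.comp (g := fun A : E →L[ℂ] E => ℓ (A x)) g h2 h1)

theorem hasFDerivAt_apply_Ad_mul (ℓ : E →L[ℂ] ℂ) (x : E) (g : G) :
    HasFDerivAt (fun w => ℓ (Ad E ((unitChart E G).symm w * g) x))
      (ℓ.comp (fderiv ℂ (fun w => Ad E ((unitChart E G).symm w) (Ad E g x)) (unitPt E G)))
      (unitPt E G) := by
  have h := (differentiableAt_Ad_apply E G (Ad E g x)).hasFDerivAt
  simpa [Ad_mul, Function.comp_def] using ℓ.hasFDerivAt.comp (unitPt E G) h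

variable (G) in
theorem bracket_self (v : E) : bracket E G v v = 0 := by
  rw [bracket_eq]; simp

variable (G) in
/-- The bracket with a fixed element, as a continuous linear map. -/
noncomputable def adL (v : E) : E →L[ℂ] E :=
  fderiv ℂ (fderiv ℂ (locMul E G)) (unitPt E G, unitPt E G) (v, 0) ∘L
    ContinuousLinearMap.inr ℂ E E -
  (fderiv ℂ (fderiv ℂ (locMul E G)) (unitPt E G, unitPt E G)).flip (0, v) ∘L
    ContinuousLinearMap.inl ℂ E E

theorem adL_apply (v w : E) : adL G v w = bracket E G v w := by
  rw [bracket_eq]; simp [adL]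

variable [ConnectedSpace G]

/-- Linear forms vanishing on brackets are invariant under the adjoint representation. -/
theorem apply_Ad_of_apply_bracket_eq_zero {m : E →L[ℂ] ℂ}
    (hm : ∀ v w, m (bracket E G v w) = 0) (g : G) (x : E) : m (Ad E g x) = m x := by
  have h := eq_of_fderiv_mul_right_eq_zero (f := fun g : G => m (Ad E g x))
    ((contMDiff_apply_Ad m x).mdifferentiable (by simp)) (fun g => ?_) g 1
  · simpa using h
  -- The derivative along the right-invariant field of `v` is `m [v, Ad g x]`, which is zero.
  · rw [(hasFDerivAt_apply_Ad_mul m x g).fderiv]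
    ext v
    simpa [fderiv_Ad_apply_eq_bracket] using hm _ _

/-- If a linear form vanishes on triple brackets, its coefficients in the coadjoint representation
are additive homomorphisms. -/
theorem apply_Ad_mul_sub {ℓ : E →L[ℂ] ℂ}
    (hℓ : ∀ u v w, ℓ (bracket E G u (bracket E G v w)) = 0) (x : E) (g h : G) :
    ℓ (Ad E (g * h) x) - ℓ x = (ℓ (Ad E g x) - ℓ x) + (ℓ (Ad E h x) - ℓ x) := by
  -- The form `ℓ ∘ ad v` kills all brackets, so it is `Ad`-invariant.
  have hinv : ∀ (v : E) (g : G) (x : E), ℓ (bracket E G v (Ad E g x)) = ℓ (bracket E G v x) := by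
    intro v g x
    have := apply_Ad_of_apply_bracket_eq_zero (m := ℓ.comp (adL G v))
      (fun a b => by simp [adL_apply, hℓ]) g x
    simpa [adL_apply] using this
  -- By `hinv` both terms have derivative `ℓ [v, x]` in the direction `v`. Their difference is thus
  -- constant, and its value at `1` gives additivity.
  have h := eq_of_fderiv_mul_right_eq_zero
    (f := fun g : G => ℓ (Ad E g (Ad E h x)) - ℓ (Ad E g x))
    (((contMDiff_apply_Ad ℓ _).sub (contMDiff_apply_Ad ℓ _)).mdifferentiable (by simp))
    (fun g => ?_) g 1
  · simp only [Ad_one, ContinuousLinearMap.id_apply] at h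
    rw [Ad_mul, ContinuousLinearMap.comp_apply]
    linear_combination h
  · refine (((hasFDerivAt_apply_Ad_mul ℓ _ g).sub
      (hasFDerivAt_apply_Ad_mul ℓ _ g)).fderiv).trans ?_
    ext v
    simp [fderiv_Ad_apply_eq_bracket, hinv]

end LieGroupChart

/-! ### Holomorphic differential equations in complex time. -/

section HolomorphicODE

variable {E : Type v} [NormedAddCommGroup E] [NormedSpace ℂ E]

open Metric

theorem norm_sub_le_of_hasDerivAt_ball {f : ℂ → E} {f' : ℂ → E} {r C : ℝ}
    (hf : ∀ z ∈ ball (0 : ℂ) r, HasDerivAt f (f' z) z) (hC : ∀ z ∈ ball (0 : ℂ) r, ‖f' z‖ ≤ C)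
    {z : ℂ} (hz : z ∈ ball (0 : ℂ) r) : ‖f z - f 0‖ ≤ C * r := by
  have hr : 0 < r := pos_of_mem_ball hz
  have hC0 : 0 ≤ C := (norm_nonneg _).trans (hC 0 (mem_ball_self hr))
  have h := (convex_ball (0 : ℂ) r).norm_image_sub_le_of_norm_hasDerivWithin_le
    (fun z hz => (hf z hz).hasDerivWithinAt) hC (mem_ball_self hr) hz
  refine h.trans (mul_le_mul_of_nonneg_left ?_ hC0)
  rw [sub_zero]
  exact (mem_ball_zero_iff.1 hz).le

/-- Local existence for holomorphic autonomous differential equations in complex time. -/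
theorem exists_hasDerivAt_complex [CompleteSpace E] {V : E → E} {o : E} (hV : ContDiffAt ℂ ω V o) :
    ∃ r > 0, ∃ y : ℂ → E, y 0 = o ∧ ∀ z ∈ ball (0 : ℂ) r, HasDerivAt y (V (y z)) z := by
  obtain ⟨K, s, hs, hK⟩ := (hV.of_le (m := 1) le_top).exists_lipschitzOnWith
  have hdiff : ∀ᶠ y in 𝓝 o, DifferentiableAt ℂ V y := by
    filter_upwards [hV.eventually (by simp)] with y hy
    exact hy.differentiableAt (by simp)
  obtain ⟨ρ, hρ, hball⟩ := Metric.mem_nhds_iff.1 (Filter.inter_mem hs hdiff)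
  set C : ℝ := ‖V o‖ + K * ρ with hCdef
  have hC : ∀ y ∈ ball o ρ, ‖V y‖ ≤ C := by
    intro y hy
    have h1 := hK.norm_sub_le (hball hy).1 (hball (mem_ball_self hρ)).1
    have h2 : ‖y - o‖ ≤ ρ := (mem_ball_iff_norm.1 hy).le
    calc ‖V y‖ = ‖V o + (V y - V o)‖ := by abel_nf
      _ ≤ ‖V o‖ + ‖V y - V o‖ := norm_add_le _ _
      _ ≤ ‖V o‖ + K * ρ := by
          have := h1.trans (mul_le_mul_of_nonneg_left h2 K.2)
          linarith
  have hC0 : 0 ≤ C := (norm_nonneg _).trans (hC o (mem_ball_self hρ))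
  -- The bound on `C * r` keeps the iterates within `ρ / 2` of `o`; the bound on `K * r` makes the
  -- Picard step a contraction with factor `1 / 2`.
  obtain ⟨r, hr, hrC, hrK⟩ : ∃ r > 0, C * r ≤ ρ / 2 ∧ K * r ≤ 1 / 2 := by
    refine ⟨min (ρ / (2 * (C + 1))) (1 / (2 * (K + 1))), by positivity, ?_, ?_⟩
    · calc C * min (ρ / (2 * (C + 1))) (1 / (2 * (K + 1))) ≤ (C + 1) * (ρ / (2 * (C + 1))) :=
            mul_le_mul (by linarith) (min_le_left _ _) (by positivity) (by positivity)
        _ = ρ / 2 := by field_simp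
    · calc K * min (ρ / (2 * (C + 1))) (1 / (2 * (K + 1))) ≤ (K + 1) * (1 / (2 * (K + 1))) :=
            mul_le_mul (by linarith) (min_le_right _ _) (by positivity) (by positivity)
        _ = 1 / 2 := by field_simp
  let T := {f : ℂ → E // DifferentiableOn ℂ f (ball 0 r) ∧ ∀ z ∈ ball (0 : ℂ) r, ‖f z - o‖ ≤ ρ / 2}
  have hmem : ∀ f : T, ∀ z ∈ ball (0 : ℂ) r, f.1 z ∈ ball o ρ := by
    intro f z hz
    rw [mem_ball_iff_norm]
    linarith [f.2.2 z hz]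
  -- Picard iteration with a holomorphic primitive on the disc in place of an integral.
  have hstep : ∀ f : T, ∃ g : T, g.1 0 = o ∧
      ∀ z ∈ ball (0 : ℂ) r, HasDerivAt g.1 (V (f.1 z)) z := by
    intro f
    have hd : DifferentiableOn ℂ (fun z => V (f.1 z)) (ball 0 r) := by
      intro z hz
      have h1 : DifferentiableAt ℂ V (f.1 z) := (hball (hmem f z hz)).2
      exact h1.comp_differentiableWithinAt z (f.2.1 z hz)
    obtain ⟨g, hg⟩ := hd.isExactOn_ball
    refine ⟨⟨fun z => g z - g 0 + o, ?_, ?_⟩, by simp, fun z hz => ?_⟩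
    · intro z hz
      exact (((hg z hz).sub_const _).add_const _).differentiableAt.differentiableWithinAt
    · intro z hz
      simp only [add_sub_cancel_right]
      exact (norm_sub_le_of_hasDerivAt_ball hg (fun z hz => hC _ (hmem f z hz)) hz).trans hrC
    · exact ((hg z hz).sub_const _).add_const _
  choose Φ hΦ0 hΦ using hstep
  let f₀ : T := ⟨fun _ => o, differentiableOn_const _, fun z _ => by simpa using (half_pos hρ).le⟩
  let F : ℕ → T := fun n => Φ^[n] f₀
  have hF : ∀ n, F (n + 1) = Φ (F n) := fun n => Function.iterate_succ_apply' _ _ _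
  have hdist : ∀ n, ∀ z ∈ ball (0 : ℂ) r, dist ((F n).1 z) ((F (n + 1)).1 z) ≤ ρ * (1 / 2) ^ n := by
    intro n
    induction n with
    | zero =>
      intro z hz
      have h1 := (F 1).2.2 z hz
      have h2 : (F 0).1 z = o := rfl
      rw [h2, dist_eq_norm, norm_sub_rev]
      simp only [pow_zero, mul_one]
      exact h1.trans (by linarith)
    | succ n ih =>
      intro z hz
      rw [dist_eq_norm, norm_sub_rev, hF (n + 1)]
      nth_rewrite 2 [hF n]
      have hd : ∀ z ∈ ball (0 : ℂ) r, HasDerivAt (fun z => (Φ (F (n + 1))).1 z - (Φ (F n)).1 z)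
          (V ((F (n + 1)).1 z) - V ((F n).1 z)) z := fun z hz => (hΦ _ z hz).sub (hΦ _ z hz)
      have hb : ∀ z ∈ ball (0 : ℂ) r, ‖V ((F (n + 1)).1 z) - V ((F n).1 z)‖ ≤
          K * (ρ * (1 / 2) ^ n) := by
        intro z hz
        refine (hK.norm_sub_le (hball (hmem _ z hz)).1 (hball (hmem _ z hz)).1).trans ?_
        gcongr
        rw [← dist_eq_norm, dist_comm]
        exact ih z hz
      have h := norm_sub_le_of_hasDerivAt_ball hd hb hz
      simp only [hΦ0, sub_self, sub_zero] at h
      refine h.trans ?_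
      calc K * (ρ * (1 / 2) ^ n) * r = (K * r) * (ρ * (1 / 2) ^ n) := by ring
        _ ≤ 1 / 2 * (ρ * (1 / 2) ^ n) := by gcongr
        _ = ρ * (1 / 2) ^ (n + 1) := by ring
  have hlim : ∀ z ∈ ball (0 : ℂ) r, ∃ l, Filter.Tendsto (fun n => (F n).1 z) Filter.atTop (𝓝 l) :=
    fun z hz => cauchySeq_tendsto_of_complete
      (cauchySeq_of_le_geometric (1 / 2) ρ (by norm_num) fun n => hdist n z hz)
  choose! y hy using hlim
  have hunif : TendstoUniformlyOn (fun n z => (F n).1 z) y Filter.atTop (ball (0 : ℂ) r) := by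
    rw [Metric.tendstoUniformlyOn_iff]
    intro ε hε
    have h1 : Filter.Tendsto (fun n : ℕ => ρ * (1 / 2 : ℝ) ^ n / (1 - 1 / 2)) Filter.atTop
        (𝓝 (ρ * 0 / (1 - 1 / 2))) :=
      ((tendsto_pow_atTop_nhds_zero_of_lt_one (by norm_num) (by norm_num)).const_mul _).div_const _
    rw [mul_zero, zero_div] at h1
    filter_upwards [h1.eventually_lt_const hε] with n hn z hz
    rw [dist_comm]
    exact (dist_le_of_le_geometric_of_tendsto (1 / 2) ρ (by norm_num)
      (fun n => hdist n z hz) (hy z hz) n).trans_lt hn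
  have hloc := hunif.tendstoLocallyUniformlyOn
  have hdF : ∀ᶠ n in Filter.atTop, DifferentiableOn ℂ (F n).1 (ball 0 r) :=
    Filter.Eventually.of_forall fun n => (F n).2.1
  have hyd := hloc.differentiableOn hdF isOpen_ball
  -- By Weierstrass the derivatives converge as well, so the equation passes to the limit.
  have hderiv := hloc.deriv hdF isOpen_ball
  refine ⟨r, hr, y, ?_, fun z hz => ?_⟩
  · refine tendsto_nhds_unique ((hy 0 (mem_ball_self hr)).comp (Filter.tendsto_add_atTop_nat 1)) ?_
    refine tendsto_const_nhds.congr fun n => ?_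
    simp [hF, hΦ0]
  · have hyo : y z ∈ ball o ρ := by
      have h : ‖y z - o‖ ≤ ρ / 2 := le_of_tendsto ((hy z hz).sub_const o).norm
        (Filter.Eventually.of_forall fun n => (F n).2.2 z hz)
      rw [mem_ball_iff_norm]
      linarith
    have h1 := ((hderiv.tendsto_at hz).comp (Filter.tendsto_add_atTop_nat 1))
    have h2 : Filter.Tendsto (fun n => V ((F n).1 z)) Filter.atTop (𝓝 (V (y z))) :=
      ((hball hyo).2.continuousAt.tendsto).comp (hy z hz)
    have h3 : deriv y z = V (y z) := by
      refine tendsto_nhds_unique h1 (h2.congr fun n => ?_)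
      simp only [Function.comp_apply, hF]
      exact (hΦ _ z hz).deriv.symm
    rw [← h3]
    exact (hyd.differentiableAt (isOpen_ball.mem_nhds hz)).hasDerivAt

/-- Uniqueness for holomorphic autonomous differential equations in complex time. -/
theorem eqOn_of_hasDerivAt_complex {V : E → E} {s : Set E} {K : NNReal} (hK : LipschitzOnWith K V s)
    {r : ℝ} {y₁ y₂ : ℂ → E} (h₁ : ∀ z ∈ ball (0 : ℂ) r, HasDerivAt y₁ (V (y₁ z)) z)
    (h₂ : ∀ z ∈ ball (0 : ℂ) r, HasDerivAt y₂ (V (y₂ z)) z)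
    (hs₁ : ∀ z ∈ ball (0 : ℂ) r, y₁ z ∈ s) (hs₂ : ∀ z ∈ ball (0 : ℂ) r, y₂ z ∈ s)
    (h0 : y₁ 0 = y₂ 0) {z : ℂ} (hz : z ∈ ball (0 : ℂ) r) : y₁ z = y₂ z := by
  let : NormedSpace ℝ E := NormedSpace.restrictScalars ℝ ℂ E
  have hmem : ∀ t ∈ Set.Icc (0 : ℝ) 1, (t : ℂ) * z ∈ ball (0 : ℂ) r := by
    intro t ht
    rw [mem_ball_zero_iff] at hz ⊢
    rw [norm_mul, Complex.norm_real, Real.norm_of_nonneg ht.1]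
    exact (mul_le_of_le_one_left (norm_nonneg _) ht.2).trans_lt hz
  -- Along the real segment from `0` to `z` the equation becomes a real one with field `z • V`, to
  -- which real uniqueness applies.
  have hd : ∀ y : ℂ → E, (∀ z ∈ ball (0 : ℂ) r, HasDerivAt y (V (y z)) z) →
      ∀ t ∈ Set.Icc (0 : ℝ) 1, HasDerivAt (fun t : ℝ => y (t * z)) (z • V (y (t * z))) t := by
    intro y hy t ht
    have h := hy _ (hmem t ht)
    have h' : HasDerivAt (fun t : ℝ => (t : ℂ) * z) z t := by
      simpa using (Complex.ofRealCLM.hasDerivAt (x := t)).mul_const z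
    exact h.scomp t h'
  have hL : ∀ t ∈ Set.Ico (0 : ℝ) 1, LipschitzOnWith (‖z‖₊ * K) (fun x => z • V x) s := by
    intro t _
    refine LipschitzOnWith.of_dist_le_mul fun a ha b hb => ?_
    rw [dist_smul₀, NNReal.coe_mul, mul_assoc, coe_nnnorm]
    exact mul_le_mul_of_nonneg_left (hK.dist_le_mul a ha b hb) (norm_nonneg _)
  have h := ODE_solution_unique_of_mem_Icc_right (v := fun _ x => z • V x) (s := fun _ => s) hL
    (f := fun t : ℝ => y₁ (t * z)) (g := fun t : ℝ => y₂ (t * z))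
    (fun t ht => (hd y₁ h₁ t ht).continuousAt.continuousWithinAt)
    (fun t ht => (hd y₁ h₁ t ⟨ht.1, ht.2.le⟩).hasDerivWithinAt)
    (fun t ht => hs₁ _ (hmem t ⟨ht.1, ht.2.le⟩))
    (fun t ht => (hd y₂ h₂ t ht).continuousAt.continuousWithinAt)
    (fun t ht => (hd y₂ h₂ t ⟨ht.1, ht.2.le⟩).hasDerivWithinAt)
    (fun t ht => hs₂ _ (hmem t ⟨ht.1, ht.2.le⟩)) (by simpa using h0)
  simpa using h (Set.right_mem_Icc.2 zero_le_one)

end HolomorphicODE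

/-! ### Extending local homomorphisms from a disc to `ℂ`. -/

section OneParameter

open Metric

theorem map_natCast_mul_of_local_hom {G : Type*} [Group G] {δ : ℝ} {e : ℂ → G}
    (he : ∀ a ∈ ball (0 : ℂ) δ, ∀ b ∈ ball (0 : ℂ) δ, e (a + b) = e a * e b) (a : ℂ) (k : ℕ)
    (hk : (k : ℂ) * a ∈ ball (0 : ℂ) δ) : e (k * a) = e a ^ k := by
  induction k with
  | zero =>
    have h0 : (0 : ℂ) ∈ ball (0 : ℂ) δ := by simpa using hk
    have := he 0 h0 0 h0
    simpa using this
  | succ k ih =>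
    have hn : ∀ j : ℕ, j ≤ k + 1 → (j : ℂ) * a ∈ ball (0 : ℂ) δ := by
      intro j hj
      rw [mem_ball_zero_iff, norm_mul, Complex.norm_natCast] at hk ⊢
      refine lt_of_le_of_lt ?_ hk
      gcongr
    have h1 := hn k (by omega)
    have h2 : a ∈ ball (0 : ℂ) δ := by simpa using hn 1 (by omega)
    rw [pow_succ, ← ih h1, ← he _ h1 _ h2]
    push_cast
    ring_nf

/-- Put `ψ z = e (z / n) ^ n` for any `n` large enough that `z / n` lies in the disc. Passing to the
common multiple `n * m` shows that the choice of `n` is immaterial. -/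
theorem exists_hom_extending_local_hom {G : Type*} [Group G] {δ : ℝ} (hδ : 0 < δ) {e : ℂ → G}
    (he : ∀ a ∈ ball (0 : ℂ) δ, ∀ b ∈ ball (0 : ℂ) δ, e (a + b) = e a * e b) :
    ∃ ψ : ℂ → G, (∀ a b, ψ (a + b) = ψ a * ψ b) ∧ ∀ z ∈ ball (0 : ℂ) δ, ψ z = e z := by
  have hdiv : ∀ (z : ℂ) (n : ℕ), 0 < n → ‖z‖ < n * δ → z / n ∈ ball (0 : ℂ) δ := by
    intro z n hn hz
    have hn' : (0 : ℝ) < n := by exact_mod_cast hn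
    rw [mem_ball_zero_iff, norm_div, Complex.norm_natCast, div_lt_iff₀ hn']
    linarith
  have hind : ∀ (z : ℂ) (n m : ℕ), 0 < n → 0 < m → ‖z‖ < n * δ → ‖z‖ < m * δ →
      e (z / n) ^ n = e (z / m) ^ m := by
    have key : ∀ (z : ℂ) (n m : ℕ), 0 < n → 0 < m → ‖z‖ < n * δ →
        e (z / n) ^ n = e (z / (n * m : ℕ)) ^ (n * m) := by
      intro z n m hn hm hz
      have hm' : (m : ℂ) ≠ 0 := by exact_mod_cast hm.ne'
      have h1 : (m : ℂ) * (z / (n * m : ℕ)) = z / n := by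
        push_cast; field_simp
      have h2 := map_natCast_mul_of_local_hom he (z / (n * m : ℕ)) m
        (by rw [h1]; exact hdiv z n hn hz)
      rw [h1] at h2
      rw [h2, ← pow_mul, mul_comm m n]
    intro z n m hn hm hzn hzm
    rw [key z n m hn hm hzn, key z m n hm hn hzm, mul_comm]
  have hex : ∀ z : ℂ, ∃ n : ℕ, 0 < n ∧ ‖z‖ < n * δ := by
    intro z
    obtain ⟨n, hn⟩ := exists_nat_gt (‖z‖ / δ)
    refine ⟨n, ?_, by rwa [div_lt_iff₀ hδ] at hn⟩
    have : (0 : ℝ) < n := lt_of_le_of_lt (by positivity) hn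
    exact_mod_cast this
  choose N hN0 hN using hex
  refine ⟨fun z => e (z / N z) ^ N z, fun a b => ?_, fun z hz => ?_⟩
  · set n := max (N a) (max (N b) (N (a + b))) with hn
    have hle : ∀ m : ℕ, m ≤ n → ∀ z : ℂ, ‖z‖ < m * δ → ‖z‖ < n * δ := fun m hm z hz =>
      hz.trans_le (by gcongr)
    have hn0 : 0 < n := (hN0 a).trans_le (le_max_left _ _)
    have ha := hle _ (by omega) a (hN a)
    have hb := hle _ (by omega) b (hN b)
    have hab := hle _ (by omega) (a + b) (hN (a + b))
    simp only
    rw [hind a _ n (hN0 a) hn0 (hN a) ha, hind b _ n (hN0 b) hn0 (hN b) hb,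
      hind (a + b) _ n (hN0 _) hn0 (hN _) hab, add_div,
      he _ (hdiv a n hn0 ha) _ (hdiv b n hn0 hb)]
    -- Values of `e` on the disc commute because addition in `ℂ` does.
    refine Commute.mul_pow ?_ n
    rw [commute_iff_eq, ← he _ (hdiv a n hn0 ha) _ (hdiv b n hn0 hb),
      ← he _ (hdiv b n hn0 hb) _ (hdiv a n hn0 ha), add_comm]
  · have h := hind z (N z) 1 (hN0 z) one_pos (hN z) (by simpa using hz)
    simpa using h

end OneParameter

/-! ### Holomorphic one-parameter subgroups. -/

namespace LieGroupChart

open Metric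

variable (E : Type v) [NormedAddCommGroup E] [NormedSpace ℂ E]
  (G : Type u) [TopologicalSpace G] [ChartedSpace E G] [Group G] [LieGroup 𝓘(ℂ, E) ω G]

/-- Left-invariance of the fields `y ↦ leftDeriv y v`: left translation by `c` carries integral
curves to integral curves. -/
theorem leftDeriv_locMul {c b : E} (hc : c ∈ (unitChart E G).target)
    (hb : b ∈ (unitChart E G).target)
    (hcb : (unitChart E G).symm c * (unitChart E G).symm b ∈ (unitChart E G).source) :
    leftDeriv E G (locMul E G (c, b)) =
      (fderiv ℂ (fun w => locMul E G (c, w)) b).comp (leftDeriv E G b) := by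
  have : IsTopologicalGroup G := isTopologicalGroup_of_complexLieGroup E G
  have h1 := hasFDerivAt_leftDeriv E G hb
  have h2 : HasFDerivAt (fun w => locMul E G (c, w)) (fderiv ℂ (fun w => locMul E G (c, w)) b)
      (locMul E G (b, unitPt E G)) := by
    have : locMul E G (b, unitPt E G) = b := by
      simp [locMul, (unitChart E G).right_inv hb]
    rw [this]
    exact (((contDiffAt_locMul E G hc hb hcb).differentiableAt (by simp)).hasFDerivAt.comp b
      (hasFDerivAt_prodMk_right (𝕜 := ℂ) c b)).differentiableAt.hasFDerivAt
  refine ((h2.comp (unitPt E G) h1).congr_of_eventuallyEq ?_).fderiv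
  have hcont : ContinuousAt (fun w => (unitChart E G).symm b * (unitChart E G).symm w)
      (unitPt E G) :=
    continuousAt_const.mul ((unitChart E G).symm.continuousAt (unitPt_mem_target E G))
  have h4 : ∀ᶠ w in 𝓝 (unitPt E G), (unitChart E G).symm b * (unitChart E G).symm w ∈
      (unitChart E G).source := by
    apply hcont.eventually_mem
    apply (unitChart E G).open_source.mem_nhds
    simpa using (unitChart E G).map_target hb
  filter_upwards [h4] with w hw
  simp only [Function.comp_apply, locMul]
  rw [(unitChart E G).left_inv hw, (unitChart E G).left_inv hcb, mul_assoc]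

theorem contDiffAt_leftDeriv_apply (v : E) :
    ContDiffAt ℂ ω (fun y => leftDeriv E G y v) (unitPt E G) := by
  have h1 : ContDiffAt ℂ ω (Function.uncurry fun y w : E => locMul E G (y, w))
      (unitPt E G, unitPt E G) := contDiffAt_locMul_left E G (unitPt_mem_target E G)
  have h2 : ContDiffAt ℂ ω (fun y => leftDeriv E G y) (unitPt E G) :=
    h1.fderiv (g := fun _ => unitPt E G) contDiffAt_const (m := ω) (by simp)
  exact h2.clm_apply contDiffAt_const

/-- Take the integral curve `y` of the left-invariant field of `v` through the identity. For fixed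
`a`, both `b ↦ y (a + b)` and `b ↦ y a * y b` are integral curves starting at `y a`, so they agree.
-/
theorem exists_local_hom [CompleteSpace E] (v : E) : ∃ δ > 0, ∃ y : ℂ → E, y 0 = unitPt E G ∧
    ContDiffAt ℂ ω y 0 ∧ HasDerivAt y v 0 ∧
    ∀ a ∈ ball (0 : ℂ) δ, ∀ b ∈ ball (0 : ℂ) δ, (unitChart E G).symm (y (a + b)) =
      (unitChart E G).symm (y a) * (unitChart E G).symm (y b) := by
  have : IsTopologicalGroup G := isTopologicalGroup_of_complexLieGroup E G
  have hV := contDiffAt_leftDeriv_apply E G v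
  obtain ⟨r, hr, y, hy0, hy⟩ := exists_hasDerivAt_complex hV
  obtain ⟨K, s, hs, hK⟩ := (hV.of_le (m := 1) le_top).exists_lipschitzOnWith
  have hyc : ContinuousAt y 0 := (hy 0 (mem_ball_self hr)).continuousAt
  have hy0t : y 0 ∈ (unitChart E G).target := hy0 ▸ unitPt_mem_target E G
  have hyt : ∀ᶠ a in 𝓝 (0 : ℂ), y a ∈ (unitChart E G).target :=
    hyc.eventually_mem ((unitChart E G).open_target.mem_nhds hy0t)
  have hec : ContinuousAt (fun a => (unitChart E G).symm (y a)) 0 :=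
    ContinuousAt.comp (g := (unitChart E G).symm) ((unitChart E G).symm.continuousAt hy0t) hyc
  have hmul : ContinuousAt (fun p : ℂ × ℂ => (unitChart E G).symm (y p.1) *
      (unitChart E G).symm (y p.2)) (0, 0) :=
    (hec.comp (x := ((0 : ℂ), (0 : ℂ))) continuousAt_fst).mul
      (hec.comp (x := ((0 : ℂ), (0 : ℂ))) continuousAt_snd)
  have hmul0 : (unitChart E G).symm (y 0) * (unitChart E G).symm (y 0) = 1 := by
    rw [hy0]; simp
  have hsrc : ∀ᶠ p : ℂ × ℂ in 𝓝 (0, 0), (unitChart E G).symm (y p.1) *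
      (unitChart E G).symm (y p.2) ∈ (unitChart E G).source := by
    apply hmul.eventually_mem
    apply (unitChart E G).open_source.mem_nhds
    rw [hmul0]; exact mem_chart_source E 1
  have hlm : ContinuousAt (fun p : ℂ × ℂ => locMul E G (y p.1, y p.2)) (0, 0) := by
    refine ContinuousAt.comp (g := unitChart E G) ((unitChart E G).continuousAt ?_) hmul
    rw [hmul0]; exact mem_chart_source E 1
  have hlm0 : locMul E G (y 0, y 0) = unitPt E G := by simp [locMul, hmul0]
  have hlms : ∀ᶠ p : ℂ × ℂ in 𝓝 (0, 0), locMul E G (y p.1, y p.2) ∈ s :=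
    hlm.eventually_mem (by rw [hlm0]; exact hs)
  have hadd : ContinuousAt (fun p : ℂ × ℂ => y (p.1 + p.2)) (0, 0) := by
    refine ContinuousAt.comp (g := y) (by simpa using hyc) (by fun_prop)
  have hadds : ∀ᶠ p : ℂ × ℂ in 𝓝 (0, 0), y (p.1 + p.2) ∈ s :=
    hadd.eventually_mem (by simpa [hy0] using hs)
  have haddt : ∀ᶠ p : ℂ × ℂ in 𝓝 (0, 0), p.1 + p.2 ∈ ball (0 : ℂ) r := by
    have : ContinuousAt (fun p : ℂ × ℂ => p.1 + p.2) (0, 0) := by fun_prop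
    exact this.eventually_mem (by simpa using ball_mem_nhds (0 : ℂ) hr)
  have hall := ((hsrc.and hlms).and (hadds.and haddt)).and
    ((hyt.prod_inl_nhds (0 : ℂ)).and (hyt.prod_inr_nhds (0 : ℂ)))
  obtain ⟨δ₀, hδ₀, hball⟩ := Metric.eventually_nhds_iff_ball.1 hall
  refine ⟨min δ₀ r, lt_min hδ₀ hr, y, hy0, ?_, ?_, fun a ha b hb => ?_⟩
  · have hd : DifferentiableOn ℂ y (ball 0 r) := fun z hz =>
      (hy z hz).differentiableAt.differentiableWithinAt
    exact (hd.analyticAt (ball_mem_nhds 0 hr)).contDiffAt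
  · have := hy 0 (mem_ball_self hr)
    simpa [hy0] using this
  · have hP : ∀ b ∈ ball (0 : ℂ) (min δ₀ r), (a, b) ∈ ball ((0 : ℂ), (0 : ℂ)) δ₀ := by
      intro b hb
      rw [← ball_prod_same]
      exact ⟨ball_subset_ball (min_le_left _ _) ha, ball_subset_ball (min_le_left _ _) hb⟩
    have heq := eqOn_of_hasDerivAt_complex (y₁ := fun b => y (a + b))
      (y₂ := fun b => locMul E G (y a, y b)) hK (r := min δ₀ r) (fun b hb => ?_) (fun b hb => ?_)
      (fun b hb => (hball _ (hP b hb)).1.2.1) (fun b hb => (hball _ (hP b hb)).1.1.2) ?_ hb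
    · rw [heq]
      exact (unitChart E G).left_inv (hball _ (hP b hb)).1.1.1
    · have h := (hy _ (hball _ (hP b hb)).1.2.2)
      exact h.comp_const_add a b
    · obtain ⟨⟨⟨h1, -⟩, -, -⟩, h2, h3⟩ := hball _ (hP b hb)
      rw [leftDeriv_locMul E G h2 h3 h1]
      have h4 : HasFDerivAt (fun w => locMul E G (y a, w))
          (fderiv ℂ (fun w => locMul E G (y a, w)) (y b)) (y b) :=
        (((contDiffAt_locMul E G h2 h3 h1).differentiableAt (by simp)).hasFDerivAt.comp (y b)
          (hasFDerivAt_prodMk_right (𝕜 := ℂ) (y a) (y b))).differentiableAt.hasFDerivAt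
      exact h4.comp_hasDerivAt b (hy b (ball_subset_ball (min_le_right _ _) hb))
    · have h2 := (hball _ (hP 0 (mem_ball_self (lt_min hδ₀ hr)))).2.1
      simp [locMul, hy0, (unitChart E G).right_inv h2]

/-- Every element of the Lie algebra of a complex Lie group is tangent to a holomorphic
one-parameter subgroup. -/
theorem exists_oneParameterSubgroup [CompleteSpace E] (v : E) : ∃ ψ : ℂ → G,
    ContMDiff 𝓘(ℂ, ℂ) 𝓘(ℂ, E) ω ψ ∧ (∀ a b, ψ (a + b) = ψ a * ψ b) ∧
      ∃ y : ℂ → E, y 0 = unitPt E G ∧ HasDerivAt y v 0 ∧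
        ∀ᶠ z in 𝓝 0, ψ z = (unitChart E G).symm (y z) := by
  obtain ⟨δ, hδ, y, hy0, hyc, hyd, hmul⟩ := exists_local_hom E G v
  obtain ⟨ψ, hψ, hψe⟩ := exists_hom_extending_local_hom
    (e := fun z => (unitChart E G).symm (y z)) hδ hmul
  have hev : ∀ᶠ z in 𝓝 (0 : ℂ), ψ z = (unitChart E G).symm (y z) :=
    Filter.eventually_of_mem (ball_mem_nhds 0 hδ) hψe
  refine ⟨ψ, fun z₀ => ?_, hψ, y, hy0, hyd, hev⟩
  have h0 : ContMDiffAt 𝓘(ℂ, ℂ) 𝓘(ℂ, E) ω ψ 0 := by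
    refine ContMDiffAt.congr_of_eventuallyEq ?_ hev
    refine ContMDiffAt.comp (g := (unitChart E G).symm) _ ?_ hyc.contMDiffAt
    exact contMDiffAt_unitChart_symm (hy0 ▸ unitPt_mem_target E G)
  -- Holomorphy at `0` spreads to every `z₀` by translation.
  have h1 : ψ = fun z => ψ z₀ * ψ (z - z₀) := by
    ext z
    rw [← hψ, add_sub_cancel]
  rw [h1]
  refine contMDiffAt_const.mul (ContMDiffAt.comp (I' := 𝓘(ℂ, ℂ)) (g := ψ) z₀ (by simpa using h0) ?_)
  rw [contMDiffAt_iff_contDiffAt]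
  fun_prop

end LieGroupChart

/-- A nonabelian nilpotent Lie algebra carries a linear form that vanishes on all triple brackets
but not on all brackets. -/
theorem exists_dual_vanishing_on_triple_brackets {K L : Type*} [Field K] [LieRing L]
    [LieAlgebra K L] (hnil : LieRing.IsNilpotent L) (hna : ¬ IsLieAbelian L) :
    ∃ ℓ : L →ₗ[K] K, (∀ u v w : L, ℓ ⁅u, ⁅v, w⁆⁆ = 0) ∧ ∃ v w : L, ℓ ⁅v, w⁆ ≠ 0 := by
  -- The series is indexed from `0`, so its term `2` is spanned by triple brackets. If it contained
  -- all brackets, the series would be stationary from term `1` on; as it reaches zero, all brackets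
  -- would vanish.
  have hex : ∃ v w : L, ⁅v, w⁆ ∉ LieModule.lowerCentralSeries K L L 2 := by
    by_contra! hcon
    have hle : LieModule.lowerCentralSeries K L L 1 ≤ LieModule.lowerCentralSeries K L L 2 := by
      rw [LieModule.lowerCentralSeries_succ, LieSubmodule.lieIdeal_oper_eq_span,
        LieSubmodule.lieSpan_le]
      rintro _ ⟨v, w, rfl⟩
      exact hcon _ _
    have hk : ∀ k, LieModule.lowerCentralSeries K L L 1 ≤
        LieModule.lowerCentralSeries K L L (k + 1) := by
      intro k
      induction k with
      | zero => exact le_rfl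
      | succ k ih =>
        refine hle.trans ?_
        rw [LieModule.lowerCentralSeries_succ K L L (k + 1),
          LieModule.lowerCentralSeries_succ K L L 1]
        exact LieSubmodule.mono_lie_right _ ih
    obtain ⟨k, hkb⟩ := LieModule.IsNilpotent.nilpotent K L L
    refine hna ⟨fun v w => ?_⟩
    have h1 : ⁅v, w⁆ ∈ LieModule.lowerCentralSeries K L L 1 := by
      rw [LieModule.lowerCentralSeries_succ]
      exact LieSubmodule.lie_mem_lie (LieSubmodule.mem_top v) (LieSubmodule.mem_top w)
    have h2 := LieModule.antitone_lowerCentralSeries K L L (Nat.le_succ k) (hk k h1)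
    rwa [hkb, LieSubmodule.mem_bot] at h2
  obtain ⟨v, w, hvw⟩ := hex
  obtain ⟨ℓ, hℓ, hℓ0⟩ := Submodule.exists_dual_map_eq_bot_of_notMem
    (p := (LieModule.lowerCentralSeries K L L 2).toSubmodule) (x := ⁅v, w⁆) hvw inferInstance
  refine ⟨ℓ, fun a b c => ?_, v, w, hℓ⟩
  have hmem : ⁅a, ⁅b, c⁆⁆ ∈ (LieModule.lowerCentralSeries K L L 2).toSubmodule := by
    change _ ∈ LieModule.lowerCentralSeries K L L 2
    rw [LieModule.lowerCentralSeries_succ, LieModule.lowerCentralSeries_succ]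
    exact LieSubmodule.lie_mem_lie (LieSubmodule.mem_top a)
      (LieSubmodule.lie_mem_lie (LieSubmodule.mem_top b) (LieSubmodule.mem_top c))
  have := Submodule.mem_map_of_mem (f := ℓ) hmem
  rwa [hℓ0, Submodule.mem_bot] at this

/-! ### Construction of the twist. -/

namespace LieGroupChart

variable {E : Type v} [NormedAddCommGroup E] [NormedSpace ℂ E]
  {G : Type u} [TopologicalSpace G] [ChartedSpace E G] [Group G] [LieGroup 𝓘(ℂ, E) ω G]

/-- An additive holomorphic function on `ℂ` is linear. -/
theorem additive_eq_mul {F : ℂ → ℂ} {c : ℂ} (hadd : ∀ a b, F (a + b) = F a + F b)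
    (hd : HasDerivAt F c 0) (s : ℂ) : F s = s * c := by
  have hF : ∀ z, HasDerivAt F c z := by
    intro z
    have h1 : F = fun x => F z + F (x - z) := by
      ext x; rw [← hadd, add_sub_cancel]
    rw [h1]
    have h2 : HasDerivAt F c (z - z) := by simpa using hd
    simpa using (h2.comp_sub_const z z).const_add (F z)
  have h0 : F 0 = 0 := by simpa using hadd 0 0
  have hconst : ∀ x y, (fun z => F z - z * c) x = (fun z => F z - z * c) y := by
    refine is_const_of_deriv_eq_zero (𝕜 := ℂ) (fun z => ?_) fun z => ?_
    · exact ((hF z).sub ((hasDerivAt_id z).mul_const c)).differentiableAt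
    · exact ((hF z).sub ((hasDerivAt_id z).mul_const c)).deriv.trans (by simp)
  have := hconst s 0
  simp only [h0] at this
  linear_combination this

variable [FiniteDimensional ℂ E] [ConnectedSpace G]

/-- The data of a twisted family on which the coadjoint coefficients are computed. -/
theorem exists_twistData {ℓ : E →L[ℂ] ℂ}
    (hℓ : ∀ u v w, ℓ (bracket E G u (bracket E G v w)) = 0)
    (hne : ∃ v w, ℓ (bracket E G v w) ≠ 0) :
    ∃ (D : TwistData E G) (m : E →L[ℂ] ℂ), m ≠ 0 ∧ (∀ g x, m (Ad E (g : G) x) = m x) ∧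
      (∀ s x, ℓ (Ad E (D.ψ s) x) = ℓ x + s * m x) ∧ ∃ g, D.lam g ≠ 0 := by
  have : CompleteSpace E := FiniteDimensional.complete ℂ E
  obtain ⟨v, w, hvw⟩ := hne
  obtain ⟨ψ, hψ, hadd, y, hy0, hyd, hy⟩ := exists_oneParameterSubgroup E G v
  have hψ0 : ψ 0 = 1 := by simpa using hadd 0 0
  set m : E →L[ℂ] ℂ := ℓ.comp (adL G v) with hm
  have hmx : ∀ x, m x = ℓ (bracket E G v x) := fun x => by simp [hm, adL_apply]
  -- For fixed `x` the left side is additive in `s` with derivative `ℓ [v, x] = m x` at `0`.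
  have key : ∀ s x, ℓ (Ad E (ψ s) x) - ℓ x = s * m x := by
    intro s x
    refine additive_eq_mul (F := fun s => ℓ (Ad E (ψ s) x) - ℓ x) (fun a b => ?_) ?_ s
    · rw [hadd]; exact apply_Ad_mul_sub hℓ x _ _
    · have h1 := hasFDerivAt_apply_Ad_mul (G := G) ℓ x 1
      rw [← hy0] at h1
      have h2 := h1.comp_hasDerivAt (0 : ℂ) hyd
      simp only [Ad_one, ContinuousLinearMap.id_apply, hy0, ContinuousLinearMap.comp_apply,
        fderiv_Ad_apply_eq_bracket, mul_one] at h2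
      rw [hmx]
      refine (h2.congr_of_eventuallyEq ?_).sub_const _
      filter_upwards [hy] with z hz
      simp [hz]
  refine ⟨⟨ψ, fun g => ℓ (Ad E g v) - ℓ v, hψ, (contMDiff_apply_Ad ℓ v).sub contMDiff_const, hadd,
    apply_Ad_mul_sub hℓ v, fun s => ?_⟩, m, ?_, fun g x => ?_, fun s x => ?_, ?_⟩
  · rw [key, hmx, bracket_self]; simp
  · intro h
    apply hvw
    rw [← hmx, h]; simp
  · exact apply_Ad_of_apply_bracket_eq_zero (fun a b => by rw [hmx, hℓ]) g x
  · linear_combination key s x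
  -- The derivative of `lam` at the identity in the direction `w` is `ℓ [w, v] = -ℓ [v, w]`, which
  -- is nonzero.
  · by_contra! hcon
    simp only at hcon
    have h1 := (hasFDerivAt_apply_Ad_mul (G := G) ℓ v 1).fderiv
    have h2 : (fun w => ℓ (Ad E ((unitChart E G).symm w * 1) v)) = fun _ => ℓ v := by
      ext w; linear_combination hcon ((unitChart E G).symm w * 1)
    rw [h2] at h1
    have h3 := DFunLike.congr_fun h1 w
    simp only [Ad_one, ContinuousLinearMap.id_apply, ContinuousLinearMap.comp_apply,
      fderiv_Ad_apply_eq_bracket] at h3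
    apply hvw
    have h4 : bracket E G v w = - bracket E G w v := by
      rw [bracket_eq, bracket_eq]; abel
    rw [h4, map_neg, ← h3]
    simp

end LieGroupChart

/-! ### Pullback of vector fields, and the maximum principle. -/

namespace LieGroupChart

section PullField

variable {E : Type v} [NormedAddCommGroup E] [NormedSpace ℂ E]
  {F : Type*} [TopologicalSpace F] [ChartedSpace E F]

/-- The pullback of a vector field under a map from the model space, as a map of the model space. -/
noncomputable def pullField (f : E → F) (V : (x : F) → TangentSpace 𝓘(ℂ, E) x) (w : E) : E :=
  VectorField.mpullback 𝓘(ℂ, E) 𝓘(ℂ, E) f V w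

theorem pullField_congr {f f' : E → F} {V : (x : F) → TangentSpace 𝓘(ℂ, E) x} {w : E}
    (h : f =ᶠ[𝓝 w] f') : pullField f V w = pullField f' V w := by
  have key : ∀ y y' : F, y = y' → ∀ L L' : E →L[ℂ] E, L = L' →
      L.inverse (V y : E) = L'.inverse (V y' : E) := by
    rintro y _ rfl L _ rfl; rfl
  exact key _ _ h.eq_of_nhds _ _ h.mfderiv_eq

theorem pullField_comp {f : E → F} {V : (x : F) → TangentSpace 𝓘(ℂ, E) x} {h : E → E} {w : E}
    {A : E →L[ℂ] E} (hf : MDifferentiableAt 𝓘(ℂ, E) 𝓘(ℂ, E) f (h w)) (hh : HasFDerivAt h A w)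
    (hA : A.IsInvertible) : pullField (f ∘ h) V w = A.inverse (pullField f V (h w)) := by
  have h1 := (hf.hasMFDerivAt.comp w hh.hasMFDerivAt).mfderiv
  have key : ∀ L M : E →L[ℂ] E, L = M.comp A →
      L.inverse (V (f (h w)) : E) = A.inverse (M.inverse (V (f (h w)) : E)) := by
    rintro _ M rfl
    exact hA.inverse_comp_apply_of_right
  exact key _ _ h1

theorem linearIndependent_pullField {ι : Type*} {f : E → F}
    {V : ι → (x : F) → TangentSpace 𝓘(ℂ, E) x} {w : E}
    (hf : IsLocalDiffeomorphAt 𝓘(ℂ, E) 𝓘(ℂ, E) ω f w)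
    (hV : LinearIndependent ℂ fun i => V i (f w)) :
    LinearIndependent ℂ fun i => pullField f (V i) w := by
  have key : ∀ L : E ≃L[ℂ] E, LinearIndependent ℂ
      (fun i => (L : E →L[ℂ] E).inverse (V i (f w) : E)) := by
    intro L
    rw [ContinuousLinearMap.inverse_equiv]
    exact hV.map' (L.symm : E →ₗ[ℂ] E) (LinearMap.ker_eq_bot.2 L.symm.injective)
  exact key (hf.mfderivToContinuousLinearEquiv (by simp))

theorem contDiffAt_pullField [CompleteSpace E] [IsManifold 𝓘(ℂ, E) ω F] {f : E → F}
    {V : (x : F) → TangentSpace 𝓘(ℂ, E) x} {w : E}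
    (hf : IsLocalDiffeomorphAt 𝓘(ℂ, E) 𝓘(ℂ, E) ω f w)
    (hV : ContMDiff 𝓘(ℂ, E) 𝓘(ℂ, E).tangent ω (fun x => (⟨x, V x⟩ : TangentBundle 𝓘(ℂ, E) F))) :
    ContDiffAt ℂ ω (pullField f V) w := by
  have : IsManifold 𝓘(ℂ, E) 1 F := IsManifold.of_le (n := ω) (by simp)
  exact contMDiffAt_vectorSpace_iff_contDiffAt.1
    (ContMDiffAt.mpullback_vectorField_preimage (n := ω) hV.contMDiffAt hf.contMDiffAt
      ⟨hf.mfderivToContinuousLinearEquiv (by simp), rfl⟩ (by simp))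

end PullField

variable {E : Type v} [NormedAddCommGroup E] [NormedSpace ℂ E]
  {G : Type u} [TopologicalSpace G] [ChartedSpace E G] [Group G] [LieGroup 𝓘(ℂ, E) ω G]

section MaximumPrinciple

variable [ConnectedSpace G] {F : Type*} [TopologicalSpace F] [CompactSpace F] {p : G → F}

/-- A holomorphic function whose real part descends to a compact quotient is constant. -/
theorem eq_of_re_invariant (hp : IsLocalHomeomorph p) (hs : Function.Surjective p) {f : G → ℂ}
    (hf : MDifferentiable 𝓘(ℂ, E) 𝓘(ℂ, ℂ) f) (hre : ∀ g h, p g = p h → (f g).re = (f h).re)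
    (a b : G) : f a = f b := by
  have hq : Topology.IsQuotientMap p := hp.isOpenMap.isQuotientMap hp.continuous hs
  -- `‖exp f‖ = exp (Re f)` descends to the compact quotient and attains its maximum, so `exp f` is
  -- constant.
  have hfe : MDifferentiable 𝓘(ℂ, E) 𝓘(ℂ, ℂ) (fun g => Complex.exp (f g)) := fun g =>
    MDifferentiableAt.comp g Complex.differentiable_exp.differentiableAt.mdifferentiableAt (hf g)
  let r : F → ℝ := fun y => (f (Function.surjInv hs y)).re
  have hr : ∀ g, r (p g) = (f g).re := fun g => hre _ _ (Function.surjInv_eq hs (p g))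
  have hrc : Continuous r := hq.continuous_iff.2
    ((Complex.continuous_re.comp hf.continuous).congr fun g => (hr g).symm)
  have : Nonempty F := ⟨p 1⟩
  obtain ⟨y, -, hy⟩ := isCompact_univ.exists_isMaxOn Set.univ_nonempty hrc.continuousOn
  obtain ⟨c, rfl⟩ := hs y
  have hmax : IsMaxOn (norm ∘ fun g => Complex.exp (f g)) Set.univ c := by
    intro g _
    simp only [Set.mem_ofPred_eq, Function.comp_apply, Complex.norm_exp]
    rw [Real.exp_le_exp, ← hr, ← hr]
    exact hy (Set.mem_univ _)
  have hconst := MDifferentiableOn.eqOn_of_isPreconnected_of_isMaxOn_norm hfe.mdifferentiableOn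
    isPreconnected_univ isOpen_univ (Set.mem_univ c) hmax
  have he : ∀ g, Complex.exp (f g) = Complex.exp (f c) := fun g => hconst (Set.mem_univ g)
  have hloc : IsLocallyConstant f := by
    rw [IsLocallyConstant.iff_eventually_eq]
    intro g
    -- Values of `f` with equal exponentials differ by multiples of `2πi`, so variation below `2π`
    -- makes `f` locally constant.
    have h1 : ∀ᶠ x in 𝓝 g, ‖f x - f g‖ < 2 * Real.pi := by
      have : ContinuousAt (fun x => ‖f x - f g‖) g :=
        (hf.continuous.sub continuous_const).norm.continuousAt
      refine this.eventually_lt continuousAt_const ?_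
      simpa using Real.pi_pos
    filter_upwards [h1] with x hx
    obtain ⟨n, hn⟩ := Complex.exp_eq_exp_iff_exists_int.1 ((he x).trans (he g).symm)
    rw [hn, add_sub_cancel_left, norm_mul, Complex.norm_intCast] at hx
    have h2 : ‖2 * (Real.pi : ℂ) * Complex.I‖ = 2 * Real.pi := by
      simp [abs_of_pos Real.pi_pos]
    rw [h2] at hx
    have h3 : |(n : ℝ)| < 1 := by
      by_contra! hcon
      nlinarith [Real.pi_pos]
    have h4 : n = 0 := by
      rw [← Int.cast_abs] at h3
      have : |n| < 1 := by exact_mod_cast h3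
      exact Int.abs_lt_one_iff.1 this
    rw [hn, h4]; simp
  exact hloc.apply_eq_of_preconnectedSpace a b

end MaximumPrinciple

end LieGroupChart

/-! ### Vector fields in the left-invariant frame. -/

namespace LieGroupChart

variable {E : Type v} [NormedAddCommGroup E] [NormedSpace ℂ E]
  {G : Type u} [TopologicalSpace G] [ChartedSpace E G] [Group G]
  {F : Type*} [TopologicalSpace F] [ChartedSpace E F]

/-- The local parametrisation of `F` around `p g` by left translation of the chart at the
identity. -/
noncomputable def leftParam (E : Type v) [NormedAddCommGroup E] [NormedSpace ℂ E]
    [ChartedSpace E G] (p : G → F) (g : G) (w : E) : F :=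
  p (g * (unitChart E G).symm w)

/-- The coefficient function of a vector field on `F` with respect to the left-invariant fields. -/
noncomputable def leftCoeff (p : G → F) (V : (x : F) → TangentSpace 𝓘(ℂ, E) x) (g : G) : E :=
  pullField (leftParam E p g) V (unitPt E G)

variable [LieGroup 𝓘(ℂ, E) ω G] {p : G → F}

theorem isLocalDiffeomorphAt_unitChart_symm :
    IsLocalDiffeomorphAt 𝓘(ℂ, E) 𝓘(ℂ, E) ω (unitChart E G).symm (unitPt E G) :=
  ⟨{ toPartialEquiv := (unitChart E G).symm.toPartialEquiv
     open_source := (unitChart E G).open_target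
     open_target := (unitChart E G).open_source
     contMDiffOn_toFun := contMDiffOn_chart_symm
     contMDiffOn_invFun := contMDiffOn_chart },
    unitPt_mem_target E G, fun _ _ => rfl⟩

theorem isLocalDiffeomorphAt_leftParam (hp : IsLocalDiffeomorph 𝓘(ℂ, E) 𝓘(ℂ, E) ω p) (g : G) :
    IsLocalDiffeomorphAt 𝓘(ℂ, E) 𝓘(ℂ, E) ω (leftParam E p g) (unitPt E G) := by
  let T : G ≃ₘ^ω⟮𝓘(ℂ, E), 𝓘(ℂ, E)⟯ G :=
    { toEquiv := Equiv.mulLeft g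
      contMDiff_toFun := contMDiff_mul_left
      contMDiff_invFun := contMDiff_mul_left }
  exact ((isLocalDiffeomorphAt_unitChart_symm (E := E) (G := G)).comp 𝓘(ℂ, E) G
    (T.isLocalDiffeomorph _)).comp 𝓘(ℂ, E) F (hp _)

theorem eventuallyEq_leftParam {y : E} (hy : y ∈ (unitChart E G).target) (g : G) :
    leftParam E p (g * (unitChart E G).symm y) =ᶠ[𝓝 (unitPt E G)]
      leftParam E p g ∘ fun w => locMul E G (y, w) := by
  have : IsTopologicalGroup G := isTopologicalGroup_of_complexLieGroup E G
  have hc : ContinuousAt (fun w => (unitChart E G).symm y * (unitChart E G).symm w)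
      (unitPt E G) :=
    continuousAt_const.mul ((unitChart E G).symm.continuousAt (unitPt_mem_target E G))
  have h4 : ∀ᶠ w in 𝓝 (unitPt E G),
      (unitChart E G).symm y * (unitChart E G).symm w ∈ (unitChart E G).source := by
    apply hc.eventually_mem
    apply (unitChart E G).open_source.mem_nhds
    simpa using (unitChart E G).map_target hy
  filter_upwards [h4] with w hw
  simp only [leftParam, locMul, Function.comp_apply]
  rw [(unitChart E G).left_inv hw, mul_assoc]

/-- Near `g` the coefficient at `g * y` is the inverse of `leftDeriv y` applied to the field read in
the single parametrisation centred at `g`; both ingredients are holomorphic in `y`. -/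
theorem mdifferentiable_leftCoeff [CompleteSpace E] [IsManifold 𝓘(ℂ, E) ω F]
    (hp : IsLocalDiffeomorph 𝓘(ℂ, E) 𝓘(ℂ, E) ω p) {V : (x : F) → TangentSpace 𝓘(ℂ, E) x}
    (hV : ContMDiff 𝓘(ℂ, E) 𝓘(ℂ, E).tangent ω (fun x => (⟨x, V x⟩ : TangentBundle 𝓘(ℂ, E) F))) :
    MDifferentiable 𝓘(ℂ, E) 𝓘(ℂ, E) (leftCoeff p V : G → E) := by
  have : IsTopologicalGroup G := isTopologicalGroup_of_complexLieGroup E G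
  intro g
  have hU := (contDiffAt_pullField (isLocalDiffeomorphAt_leftParam hp g) hV).differentiableAt
    (by simp)
  have hL : ContDiffAt ℂ ω (leftDeriv E G) (unitPt E G) := by
    have h1 : ContDiffAt ℂ ω (Function.uncurry fun y w : E => locMul E G (y, w))
        (unitPt E G, unitPt E G) := contDiffAt_locMul_left E G (unitPt_mem_target E G)
    exact h1.fderiv (g := fun _ => unitPt E G) contDiffAt_const (m := ω) (by simp)
  have hid : (leftDeriv E G (unitPt E G)).IsInvertible :=
    ⟨ContinuousLinearEquiv.refl ℂ E, by rw [leftDeriv_unitPt]; rfl⟩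
  have hinv := (ContDiffAt.comp (unitPt E G)
    (hid.contDiffAt_map_inverse (n := ω)) hL).differentiableAt (by simp)
  have hloc := hinv.clm_apply hU
  have hev : ∀ᶠ y in 𝓝 (unitPt E G), (leftCoeff p V (g * (unitChart E G).symm y) : E) =
      (leftDeriv E G y).inverse (pullField (leftParam E p g) V y) := by
    have h2 : ∀ᶠ y in 𝓝 (unitPt E G), (leftDeriv E G y).IsInvertible := by
      obtain ⟨e, he⟩ := hid
      have := hL.continuousAt.eventually_mem
        ((ContinuousLinearEquiv.isOpen (𝕜 := ℂ) (E := E) (F := E)).mem_nhds ⟨e, he⟩)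
      exact this
    have h3 : ∀ᶠ y in 𝓝 (unitPt E G),
        MDifferentiableAt 𝓘(ℂ, E) 𝓘(ℂ, E) (leftParam E p g) y := by
      filter_upwards [unitPt_eventually_mem_target E G] with y hy
      refine (ContMDiffAt.comp (g := p) y (hp.contMDiff _) ?_).mdifferentiableAt (n := ω) (by simp)
      exact contMDiffAt_const.mul (contMDiffAt_unitChart_symm hy)
    filter_upwards [unitPt_eventually_mem_target E G, h2, h3] with y hy hy2 hy3
    have h5 : locMul E G (y, unitPt E G) = y := by
      simp [locMul, (unitChart E G).right_inv hy]
    rw [leftCoeff, pullField_congr (eventuallyEq_leftParam hy g),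
      pullField_comp (by rw [h5]; exact hy3) (hasFDerivAt_leftDeriv E G hy) hy2, h5]
  have hfin : DifferentiableAt ℂ (fun y => (leftCoeff p V (g * (unitChart E G).symm y) : E))
      (unitPt E G) := hloc.congr_of_eventuallyEq hev
  have hch : ContMDiffAt 𝓘(ℂ, E) 𝓘(ℂ, E) ω (fun x : G => unitChart E G (g⁻¹ * x)) g :=
    ContMDiffAt.comp (g := unitChart E G) g (contMDiffAt_unitChart (by simp))
      (contMDiff_mul_left (a := g⁻¹)).contMDiffAt
  have hg : unitPt E G = unitChart E G (g⁻¹ * g) := by simp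
  rw [hg] at hfin
  refine (MDifferentiableAt.comp g hfin.mdifferentiableAt
    (hch.mdifferentiableAt (by simp))).congr_of_eventuallyEq ?_
  have hc : ContinuousAt (fun x : G => g⁻¹ * x) g := by fun_prop
  have hs : ∀ᶠ x in 𝓝 g, g⁻¹ * x ∈ (unitChart E G).source := by
    apply hc.eventually_mem
    apply (unitChart E G).open_source.mem_nhds
    simp
  filter_upwards [hs] with x hx
  simp only [Function.comp_apply]
  rw [(unitChart E G).left_inv hx, mul_inv_cancel_left]

/-- If `p` is invariant under `g ↦ γ * g * s⁻¹`, the left coefficients transform by the adjoint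
representation. -/
theorem leftCoeff_mul_mul_inv (hp : IsLocalDiffeomorph 𝓘(ℂ, E) 𝓘(ℂ, E) ω p)
    (V : (x : F) → TangentSpace 𝓘(ℂ, E) x) {γ s : G} (h : ∀ g, p (γ * g * s⁻¹) = p g) (g : G) :
    (leftCoeff p V (γ * g * s⁻¹) : E) = Ad E s (leftCoeff p V g) := by
  -- By invariance `p (γ g s⁻¹ w) = p (g (s⁻¹ w s))`, so the two parametrisations differ by
  -- conjugation by `s⁻¹`, and pulling back inverts `Ad s⁻¹`.
  have h1 : leftParam E p (γ * g * s⁻¹) =ᶠ[𝓝 (unitPt E G)] leftParam E p g ∘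
      fun w => unitChart E G (s⁻¹ * (unitChart E G).symm w * s⁻¹⁻¹) := by
    filter_upwards [eventually_conj_mem_source E s⁻¹] with w hw
    simp only [leftParam, Function.comp_apply]
    rw [(unitChart E G).left_inv hw, ← h (g * _)]
    congr 1; group
  have h2 : unitChart E G (s⁻¹ * (unitChart E G).symm (unitPt E G) * s⁻¹⁻¹) = unitPt E G := by
    simp
  have hA : (Ad E s).comp (Ad E s⁻¹) = ContinuousLinearMap.id ℂ E := by
    rw [← Ad_mul]; simp
  have hA' : (Ad E s⁻¹).comp (Ad E s) = ContinuousLinearMap.id ℂ E := by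
    rw [← Ad_mul]; simp
  let e : E ≃L[ℂ] E := ContinuousLinearEquiv.equivOfInverse (Ad E s⁻¹) (Ad E s)
    (fun x => DFunLike.congr_fun hA x) (fun x => DFunLike.congr_fun hA' x)
  have hd := (isLocalDiffeomorphAt_leftParam hp g).contMDiffAt.mdifferentiableAt (by simp)
  rw [leftCoeff, pullField_congr h1,
    pullField_comp (by rw [h2]; exact hd) (hasFDerivAt_Ad E G s⁻¹) ⟨e, rfl⟩, h2]
  change (e : E →L[ℂ] E).inverse _ = _
  rw [ContinuousLinearMap.inverse_equiv]
  rfl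

theorem linearIndependent_leftCoeff (hp : IsLocalDiffeomorph 𝓘(ℂ, E) 𝓘(ℂ, E) ω p) {ι : Type*}
    {V : ι → (x : F) → TangentSpace 𝓘(ℂ, E) x} (hV : ∀ x, LinearIndependent ℂ fun i => V i x)
    (g : G) : LinearIndependent ℂ fun i => (leftCoeff p (V i) g : E) :=
  linearIndependent_pullField (isLocalDiffeomorphAt_leftParam hp g) (hV _)

end LieGroupChart

/-! ### Failure of parallelisability for nonzero parameters. -/

namespace LieGroupChart

variable {E : Type v} [NormedAddCommGroup E] [NormedSpace ℂ E]
  {G : Type u} [TopologicalSpace G] [ChartedSpace E G] [Group G] [LieGroup 𝓘(ℂ, E) ω G]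
  [ConnectedSpace G]

/-- If a multiple of the conjugate of a holomorphic function `lam` and a holomorphic function `u` have
the same increments along the fibres of a projection to a compact space, then `lam` is constant. -/
theorem eq_of_conj_periods {F : Type*} [TopologicalSpace F] [CompactSpace F] {p : G → F}
    (hp : IsLocalHomeomorph p) (hs : Function.Surjective p) {lam u : G → ℂ} {a : ℂ} (ha : a ≠ 0)
    (hlam : MDifferentiable 𝓘(ℂ, E) 𝓘(ℂ, ℂ) lam) (hu : MDifferentiable 𝓘(ℂ, E) 𝓘(ℂ, ℂ) u)
    (hper : ∀ g h, p g = p h → u h - u g = a * starRingEnd ℂ (lam h - lam g)) (g h : G) :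
    lam g = lam h := by
  have hc : ∀ c : ℂ, MDifferentiable 𝓘(ℂ, E) 𝓘(ℂ, ℂ) (fun g => c * lam g) := fun c g =>
    MDifferentiableAt.comp g (differentiableAt_id.const_mul c).mdifferentiableAt (hlam g)
  -- The increments of `u` and `conj a * lam` are complex conjugates of each other, so their
  -- difference has imaginary increments and their sum real ones. Multiplying the sum by `I` makes
  -- `eq_of_re_invariant` apply to both.
  have h1 := eq_of_re_invariant (E := E) hp hs (f := fun g => u g - starRingEnd ℂ a * lam g)
    (hu.sub (hc _)) (fun x y hxy => ?_) g h
  · have hsum : MDifferentiable 𝓘(ℂ, E) 𝓘(ℂ, ℂ)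
        (fun g => Complex.I * (u g + starRingEnd ℂ a * lam g)) := fun g =>
      MDifferentiableAt.comp (g := fun z : ℂ => Complex.I * z) g
        (differentiableAt_id.const_mul Complex.I).mdifferentiableAt ((hu.add (hc _)) g)
    have h2 := eq_of_re_invariant (E := E) hp hs hsum (fun x y hxy => ?_) g h
    · have h3 := mul_left_cancel₀ Complex.I_ne_zero h2
      have h4 : starRingEnd ℂ a ≠ 0 := by simpa using ha
      apply mul_left_cancel₀ h4
      linear_combination (h3 - h1) / 2
    · have h3 := hper x y hxy
      have hy : u y = u x + a * starRingEnd ℂ (lam y - lam x) := by rw [← h3]; ring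
      rw [hy]
      simp
      ring
  · have h3 := hper x y hxy
    have hy : u y = u x + a * starRingEnd ℂ (lam y - lam x) := by rw [← h3]; ring
    rw [hy]
    simp
    ring

/-- The quotients of `G` by the deformed actions at nonzero parameters are not complex
parallelisable. -/
theorem not_isComplexParallelisable [FiniteDimensional ℂ E] (D : TwistData E G) {ℓ m : E →L[ℂ] ℂ} (hm0 : m ≠ 0)
    (hm : ∀ (g : G) x, m (Ad E g x) = m x) (hℓ : ∀ s x, ℓ (Ad E (D.ψ s) x) = ℓ x + s * m x)
    (hlam : ∃ g, D.lam g ≠ 0) (Γ : Subgroup G) {t : ℂ} (ht : t ≠ 0)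
    {F : Type*} [TopologicalSpace F] [ChartedSpace E F] [IsManifold 𝓘(ℂ, E) ω F] [CompactSpace F]
    {p : G → F} (hp : IsLocalDiffeomorph 𝓘(ℂ, E) 𝓘(ℂ, E) ω p) (hs : Function.Surjective p)
    (hdeck : ∀ γ ∈ Γ, ∀ g, p (D.deck γ t g) = p g)
    (hfib : ∀ g h, p g = p h → ∃ γ ∈ Γ, D.deck γ t g = h) :
    ¬ IsComplexParallelisable E F := by
  rintro ⟨V, hV, hli⟩
  have : CompleteSpace E := FiniteDimensional.complete ℂ E
  -- The coefficients of the frame at `1` form a basis of `E`, on which the nonzero form `m` cannot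
  -- vanish identically.
  obtain ⟨i, hi⟩ : ∃ i, m (leftCoeff p (V i) (1 : G)) ≠ 0 := by
    by_contra! hcon
    apply hm0
    have hspan := (linearIndependent_leftCoeff (G := G) hp hli 1).span_eq_top_of_card_eq_finrank'
      (by simp)
    ext x
    have hx : x ∈ Submodule.span ℂ (Set.range fun i => (leftCoeff p (V i) (1 : G) : E)) := by
      rw [hspan]; trivial
    induction hx using Submodule.span_induction with
    | mem x hx => obtain ⟨i, rfl⟩ := hx; exact hcon i
    | zero => simp
    | add x y _ _ hx hy => simp [hx, hy]
    | smul a x _ hx => simp [hx]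
  have hinv : ∀ s, D.ψ (-s) = (D.ψ s)⁻¹ := fun s => eq_inv_of_mul_eq_one_left (D.ψ_neg_mul s)
  have hcoeff : ∀ γ ∈ Γ, ∀ g, (leftCoeff p (V i) (D.deck γ t g) : E) =
      Ad E (D.ψ (t * starRingEnd ℂ (D.lam γ))) (leftCoeff p (V i) g) := by
    intro γ hγ g
    simp only [TwistData.deck, hinv] at hdeck ⊢
    exact leftCoeff_mul_mul_inv hp (V i) (hdeck γ hγ) g
  have hf := mdifferentiable_leftCoeff (G := G) hp (hV i)
  have hcomp : ∀ k : E →L[ℂ] ℂ, MDifferentiable 𝓘(ℂ, E) 𝓘(ℂ, ℂ)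
      (fun g : G => k (leftCoeff p (V i) g)) := fun k g =>
    MDifferentiableAt.comp g k.differentiableAt.mdifferentiableAt (hf g)
  have hmc : ∀ g : G, m (leftCoeff p (V i) g) = m (leftCoeff p (V i) (1 : G)) := fun g =>
    eq_of_re_invariant hp.isLocalHomeomorph hs (hcomp m) (fun x y hxy => by
      obtain ⟨γ, hγ, rfl⟩ := hfib x y hxy
      rw [hcoeff γ hγ, hm]) g 1
  have hlam1 : D.lam 1 = 0 := by simpa using D.lam_mul 1 1
  obtain ⟨g₀, hg₀⟩ := hlam
  -- Here `u = ℓ ∘ f` and `a = t * m (f 1)` for the coefficient function `f` of `V i`; the increment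
  -- formula is `hℓ` at `s = t * conj (lam γ)`.
  refine hg₀ ((eq_of_conj_periods hp.isLocalHomeomorph hs (mul_ne_zero ht hi)
    (D.contMDiff_lam.mdifferentiable (by simp)) (hcomp ℓ) (fun x y hxy => ?_) g₀ 1).trans hlam1)
  obtain ⟨γ, hγ, rfl⟩ := hfib x y hxy
  rw [hcoeff γ hγ, hℓ, hmc, D.lam_deck]
  simp only [add_sub_cancel_right, add_sub_cancel_left]
  ring

end LieGroupChart

/-! ### Conclusion. -/

theorem corollary5p2
    {E : Type v} [NormedAddCommGroup E] [NormedSpace ℂ E] [FiniteDimensional ℂ E]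
    {G : Type u} [TopologicalSpace G] [T2Space G] [ChartedSpace E G] [Group G]
    [LieGroup 𝓘(ℂ, E) ω G] [SimplyConnectedSpace G]
    (hnil : LieRing.IsNilpotent (GroupLieAlgebra 𝓘(ℂ, E) G))
    (Γ : Subgroup G) [DiscreteTopology Γ] [CompactSpace (LatticeQuotient Γ)]
    (hna : ¬ IsLieAbelian (GroupLieAlgebra 𝓘(ℂ, E) G)) :
    ∃ (Y : Type u) (_ : TopologicalSpace Y) (_ : T2Space Y) (_ : SecondCountableTopology Y)
      (_ : ConnectedSpace Y) (_ : ChartedSpace (E × ℂ) Y) (_ : IsManifold 𝓘(ℂ, E × ℂ) ω Y)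
      (π : Y → openUnitDisc) (ι : LatticeQuotient Γ → Y),
      IsDeformation E ℂ π openUnitDisc.centre ι ∧
      ∀ ε > 0, ∃ t : openUnitDisc, ‖(t : ℂ)‖ < ε ∧
        ∃ (F : Type u) (_ : TopologicalSpace F) (_ : ChartedSpace E F)
          (_ : IsManifold 𝓘(ℂ, E) ω F) (κ : F → Y),
          IsFibreEmbedding E ℂ π t κ ∧ ¬ IsComplexParallelisable E F := by
  have : CompleteSpace E := FiniteDimensional.complete ℂ E
  have hex : ∃ ℓ : E →L[ℂ] ℂ,
      (∀ u v w, ℓ (LieGroupChart.bracket E G u (LieGroupChart.bracket E G v w)) = 0) ∧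
      ∃ v w, ℓ (LieGroupChart.bracket E G v w) ≠ 0 := by
    obtain ⟨ℓ, h1, h2⟩ := exists_dual_vanishing_on_triple_brackets (K := ℂ) hnil hna
    let ℓ' : E →ₗ[ℂ] ℂ := ℓ
    exact ⟨LinearMap.toContinuousLinearMap ℓ', h1, h2⟩
  obtain ⟨ℓ, h1, h2⟩ := hex
  obtain ⟨D, m, hm0, hm, hℓ, hlam⟩ := LieGroupChart.exists_twistData h1 h2
  obtain ⟨Y, i1, i2, i3, i4, i5, i6, π, ι, hdef, hfib⟩ := D.exists_deformation Γ
  refine ⟨Y, i1, i2, i3, i4, i5, i6, π, ι, hdef, fun ε hε => ?_⟩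
  -- The parameter `t = min ε 1 / 2` is nonzero, lies in the disc and has norm below `ε`.
  have hpos : 0 < min ε 1 / 2 := half_pos (lt_min hε one_pos)
  have hnorm : ‖((min ε 1 / 2 : ℝ) : ℂ)‖ = min ε 1 / 2 := by
    rw [Complex.norm_real, Real.norm_of_nonneg hpos.le]
  let t : openUnitDisc := ⟨((min ε 1 / 2 : ℝ) : ℂ), mem_ball_zero_iff.2 (by
    rw [hnorm]; linarith [min_le_right ε 1])⟩
  obtain ⟨F, j1, j2, j3, κ, p, hκ, hc, hs, hp, hdeck, hfb⟩ := hfib t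
  refine ⟨t, ?_, F, j1, j2, j3, κ, hκ, ?_⟩
  · exact hnorm.trans_lt (by linarith [min_le_left ε 1])
  · exact LieGroupChart.not_isComplexParallelisable D hm0 hm hℓ hlam Γ
      (Complex.ofReal_ne_zero.2 hpos.ne') hp hs hdeck hfb
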